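/- Let $X$ and $D$ be complex Banach spaces with $D$ densely and continuously embedded in $X$, let $T>0$ and $J=(0,T)$. For $r\in(1,\infty)$ let $W^{1,r}_0(J;X)$ be the space of all $u\in L^r(J;X)$ whose $X$-valued distributional derivative $u'$ belongs to $L^r(J;X)$ and whose continuous representative satisfies $u(0)=0$. Consider families $\{A(t)\}_{t\in J}$ in $\mathcal L(D;X)$ which are bounded, i.e. $\sup_{t\in J}\|A(t)\|_{D\to X}<\infty$, (strongly) measurable, i.e. $t\mapsto A(t)\psi\in X$ is Bochner measurable on $J$ for every $\psi\in D$, and such that for every $t\in J$ the operator $A(t)$, viewed as an operator in $X$ with domain $D$, is closed. Such a family is said to satisfy maximal parabolic $L^r(J;X)$-regularity if for every $f\in L^r(J;X)$ there is a unique $u\in L^r(J;D)\cap W^{1,r}_0(J;X)$ with $$u'(t)+A(t)u(t)=f(t)\quad\text{for almost all }t\in J.$$ A single operator $K\in\mathcal L(D;X)$ is said to satisfy maximal parabolic regularity on $X$ if the constant family $A(t)=K$ satisfies maximal parabolic $L^p(J;X)$-regularity for some $p\in(1,\infty)$. **Corollary 3.5.** Let $\{B(t)\}_{t\in J}$ be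 a bounded and measurable family in $\mathcal L(D;X)$ such that $B(t)$ is closed in $X$ for every $t\in J$. Suppose that there is an operator $K\in\mathcal L(D;X)$ which satisfies maximal parabolic regularity on $X$. Let $r\in(1,\infty)$ and suppose that $\{B(t)\}_{t\in J}$ satisfies maximal parabolic $L^r(J;X)$-regularity. Then there exists an open interval $I\subset(1,\infty)$ with $r\in I$ such that $\{B(t)\}_{t\in J}$ satisfies maximal parabolic $L^s(J;X)$-regularity for all $s\in I$. -/

import Mathlib

open MeasureTheory Set
open scoped ContDiff

namespace ParabolicReg

/-- Lebesgue measure on the time interval `J = (0, T)`. Functions on `J` are represented by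
functions on `ℝ` whose values outside `J` play no role. -/
noncomputable def timeMeasure (T : ℝ) : Measure ℝ :=
  volume.restrict (Ioo 0 T)

/-- `f ∈ L^r(J; X)`: Bochner measurable with `∫_J ‖f‖^r < ∞`. -/
def MemLr {X : Type*} [NormedAddCommGroup X] (T r : ℝ) (f : ℝ → X) : Prop :=
  MemLp f (ENNReal.ofReal r) (timeMeasure T)

/-- `u'` is the derivative of `u` on `J = (0, T)` in the sense of `X`-valued distributions,
both being locally integrable: `∫_J φ' u = - ∫_J φ u'` for every test function
`φ ∈ C_c^∞(J)`. -/
structure HasWeakDeriv {X : Type*} [NormedAddCommGroup X] [NormedSpace ℝ X]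
    (T : ℝ) (u u' : ℝ → X) : Prop where
  locallyIntegrable : LocallyIntegrableOn u (Ioo 0 T)
  locallyIntegrable_deriv : LocallyIntegrableOn u' (Ioo 0 T)
  integral_eq : ∀ φ : ℝ → ℝ, ContDiff ℝ ∞ φ → HasCompactSupport φ → tsupport φ ⊆ Ioo 0 T →
    ∫ t in Ioo 0 T, deriv φ t • u t = - ∫ t in Ioo 0 T, φ t • u' t

/-- `u ∈ W^{1,r}(J; X)`. -/
def MemW1 {X : Type*} [NormedAddCommGroup X] [NormedSpace ℝ X] (T r : ℝ) (u : ℝ → X) : Prop :=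
  MemLr T r u ∧ ∃ u' : ℝ → X, MemLr T r u' ∧ HasWeakDeriv T u u'

/-- `u(0) = 0` for the representative of `u` that is continuous on `[0, T]`. -/
def VanishesAtZero {X : Type*} [NormedAddCommGroup X] (T : ℝ) (u : ℝ → X) : Prop :=
  ∃ v : ℝ → X, ContinuousOn v (Icc 0 T) ∧ u =ᵐ[timeMeasure T] v ∧ v 0 = 0

/-- `u ∈ W_0^{1,r}(J; X) = {ψ ∈ W^{1,r}(J; X) : ψ(0) = 0}`. -/
def MemW10 {X : Type*} [NormedAddCommGroup X] [NormedSpace ℝ X] (T r : ℝ) (u : ℝ → X) : Prop :=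
  MemW1 T r u ∧ VanishesAtZero T u

section

variable {D X : Type*} [NormedAddCommGroup D] [NormedSpace ℂ D]
  [NormedAddCommGroup X] [NormedSpace ℂ X]

/-- `u ∈ MR_0^r(J; D, X) = L^r(J; D) ∩ W_0^{1,r}(J; X)`, where `ι` is the embedding of `D`
into `X`. -/
def MemMR (ι : D →L[ℂ] X) (T r : ℝ) (u : ℝ → D) : Prop :=
  MemLr T r u ∧ MemW10 T r (fun t => ι (u t))

/-- `u'(t) + A(t) u(t) = f(t)` for almost all `t ∈ J`, where `u'` is the distributional
derivative of `u` as a function with values in `X`. -/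
def SolvesAE (ι : D →L[ℂ] X) (T : ℝ) (A : ℝ → D →L[ℂ] X) (u : ℝ → D) (f : ℝ → X) : Prop :=
  ∃ u' : ℝ → X, HasWeakDeriv T (fun t => ι (u t)) u' ∧
    ∀ᵐ t ∂(timeMeasure T), u' t + A t (u t) = f t

/-- The operator `A`, regarded as an operator in `X` with domain `D`, is closed: its graph is
closed in `X × X`. -/
def IsClosedIn (ι A : D →L[ℂ] X) : Prop :=
  IsClosed (range fun d : D => (ι d, A d))

/-- The family `{A(t)}`, `t ∈ J`, is bounded in `L(D; X)`, measurable (each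
`t ↦ A(t) ψ`, `ψ ∈ D`, is Bochner measurable), and consists of operators that are closed
in `X`. -/
structure IsAdmissible (ι : D →L[ℂ] X) (T : ℝ) (A : ℝ → D →L[ℂ] X) : Prop where
  bounded : ∃ C : ℝ, ∀ t ∈ Ioo 0 T, ‖A t‖ ≤ C
  measurable : ∀ ψ : D, AEStronglyMeasurable (fun t => A t ψ) (timeMeasure T)
  closed : ∀ t ∈ Ioo 0 T, IsClosedIn ι (A t)

/-- Non-autonomous maximal parabolic `L^r(J; X)`-regularity of `{A(t)}`, `t ∈ J`: the family is
admissible, and for every `f ∈ L^r(J; X)` there is a unique (as an almost everywhere class)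
`u ∈ MR_0^r(J; D, X)` with `u' + A(·) u = f` almost everywhere on `J`. -/
structure HasMaxReg (ι : D →L[ℂ] X) (T r : ℝ) (A : ℝ → D →L[ℂ] X) : Prop where
  admissible : IsAdmissible ι T A
  exists_unique : ∀ f : ℝ → X, MemLr T r f →
    ∃ u : ℝ → D, (MemMR ι T r u ∧ SolvesAE ι T A u f) ∧
      ∀ v : ℝ → D, MemMR ι T r v ∧ SolvesAE ι T A v f → v =ᵐ[timeMeasure T] u

/-- The single operator `K` satisfies maximal parabolic regularity on `X`: the constant family
`K` satisfies maximal parabolic `L^p(J; X)`-regularity for some `p ∈ (1, ∞)`. -/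
def HasAutonomousMaxReg (ι : D →L[ℂ] X) (T : ℝ) (K : D →L[ℂ] X) : Prop :=
  ∃ p : ℝ, 1 < p ∧ HasMaxReg ι T p (fun _ => K)

end

end ParabolicReg

/-!
Let `g = ‖u‖ + ‖u'‖`. At height `l`, average `u` over intervals whose length is Lipschitz in time
and proportional to the distance to the set where the maximal function of `g` is at most `l`. The
result `v` solves `ι v = ∫ v'` again, coincides with `u` on that set, and `‖v‖ + ‖v'‖` is bounded by
a multiple of `l` off it, so this is a Lipschitz truncation at the level of the pair `(u, u')`.

The open mapping theorem gives an a priori estimate in `L^r`. Applied to `u - v`, it controls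
`∫ g ^ r` over `{l < g}`; applied to `v`, it controls the integral over `{g ≤ l}`. In both cases the
bound involves the corresponding part of `u' + B u` and the term `l ^ (r - 1) ∫ g` over
`{l / 2 < g}`. Multiplying by `l ^ (s - r - 1)` and integrating over `l`, the last term acquires the
factor `|s - r|` and is absorbed. The first inequality thus gives higher integrability of the
solution for `s > r`; the second gives an a priori estimate in `L^s` for `s < r`, and there the
range of the parabolic operator is dense because it contains `L^r`.
-/

namespace ParabolicReg

open Filter TopologicalSpace Topology ENNReal NNReal
open scoped Distributions

section WeakDerivative

variable {X : Type*} [NormedAddCommGroup X] [NormedSpace ℝ X] {T : ℝ}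

theorem setIntegral_smul_setIntegral_Ioo [CompleteSpace X] {a b : ℝ} {g : ℝ → ℝ} {w : ℝ → X}
    (hg : IntegrableOn g (Ioo a b)) (hw : IntegrableOn w (Ioo a b)) :
    ∫ t in Ioo a b, g t • ∫ τ in Ioo a t, w τ =
      ∫ τ in Ioo a b, (∫ t in Ioo τ b, g t) • w τ := by
  let F : ℝ → ℝ → X := Function.curry ({p : ℝ × ℝ | p.2 < p.1}.indicator fun p => g p.1 • w p.2)
  have hF : ∀ t τ, F t τ = {p : ℝ × ℝ | p.2 < p.1}.indicator (fun p => g p.1 • w p.2) (t, τ) :=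
    fun _ _ => rfl
  have hF_int : Integrable (Function.uncurry F)
      ((volume.restrict (Ioo a b)).prod (volume.restrict (Ioo a b))) :=
    (Integrable.smul_prod hg hw).indicator (measurableSet_lt measurable_snd measurable_fst)
  have integral_left : ∀ t ∈ Ioo a b, ∫ τ in Ioo a b, F t τ = g t • ∫ τ in Ioo a t, w τ := by
    intro t ht
    have hFt : F t = (Iio t).indicator fun τ => g t • w τ := by
      ext τ; simp [hF, indicator]
    rw [hFt, setIntegral_indicator measurableSet_Iio, Ioo_inter_Iio, min_eq_right ht.2.le,
      integral_smul]
  have integral_right : ∀ τ ∈ Ioo a b, ∫ t in Ioo a b, F t τ = (∫ t in Ioo τ b, g t) • w τ := by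
    intro τ hτ
    have hFτ : (fun t => F t τ) = (Ioi τ).indicator fun t => g t • w τ := by
      ext t; simp [hF, indicator]
    rw [hFτ, setIntegral_indicator measurableSet_Ioi, Ioo_inter_Ioi, max_eq_right hτ.1.le,
      integral_smul_const]
  rw [← setIntegral_congr_fun measurableSet_Ioo integral_left, integral_integral_swap hF_int]
  exact setIntegral_congr_fun measurableSet_Ioo integral_right

theorem tsupport_primitive_subset_Icc {a b : ℝ} {η : ℝ → X} (hη : Function.support η ⊆ Icc a b)
    (hη_zero : ∫ t, η t = 0) : tsupport (fun t => ∫ τ in a..t, η τ) ⊆ Icc a b := by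
  refine closure_minimal (fun t ht => not_not.1 fun ht_notMem => ht ?_) isClosed_Icc
  have η_eq_zero : ∀ τ, τ ∉ Icc a b → η τ = 0 := fun τ hτ =>
    Function.notMem_support.1 fun h => hτ (hη h)
  rcases le_or_gt a t with hat | hta
  · have hbt : b ≤ t := le_of_not_ge fun htb => ht_notMem ⟨hat, htb⟩
    beta_reduce
    rw [intervalIntegral.integral_of_le hat, ← integral_Icc_eq_integral_Ioc,
      setIntegral_eq_integral_of_forall_compl_eq_zero, hη_zero]
    exact fun τ hτ => η_eq_zero τ fun h => hτ ⟨h.1, h.2.trans hbt⟩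
  · refine intervalIntegral.integral_zero_ae ?_
    filter_upwards [Measure.ae_ne volume a] with τ hτ hmem
    rw [uIoc_of_ge hta.le] at hmem
    exact η_eq_zero τ fun h => hτ (le_antisymm hmem.2 h.1)

/-- The interval `J = (0, T)` as an open set: the domain of Mathlib's spaces of test functions. -/
def timeInterval (T : ℝ) : Opens ℝ := ⟨Ioo 0 T, isOpen_Ioo⟩

/-- The derivative of a test function on `J`, as a test function on `J`. -/
noncomputable def derivTestFunction (φ : 𝓓(timeInterval T, ℝ)) : 𝓓(timeInterval T, ℝ) where
  toFun := deriv φ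
  contDiff' := (contDiff_infty_iff_deriv.1 φ.contDiff).2
  hasCompactSupport' := φ.hasCompactSupport.deriv
  tsupport_subset' := tsupport_deriv_subset.trans φ.tsupport_subset

theorem coe_derivTestFunction (φ : 𝓓(timeInterval T, ℝ)) : ⇑(derivTestFunction φ) = deriv φ := rfl

theorem exists_tsupport_subset_Icc (hT : 0 < T) (η : 𝓓(timeInterval T, ℝ)) :
    ∃ a b, 0 < a ∧ b < T ∧ tsupport η ⊆ Icc a b := by
  have hK : IsCompact (insert (T / 2) (tsupport η)) := η.hasCompactSupport.insert _
  have hKT : insert (T / 2) (tsupport η) ⊆ Ioo 0 T :=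
    insert_subset ⟨by linarith, by linarith⟩ η.tsupport_subset
  obtain ⟨a, ha⟩ := hK.exists_isLeast (insert_nonempty _ _)
  obtain ⟨b, hb⟩ := hK.exists_isGreatest (insert_nonempty _ _)
  exact ⟨a, b, (hKT ha.1).1, (hKT hb.1).2, fun t ht =>
    ⟨ha.2 (mem_insert_of_mem _ ht), hb.2 (mem_insert_of_mem _ ht)⟩⟩

theorem exists_derivTestFunction_eq (hT : 0 < T) {η : 𝓓(timeInterval T, ℝ)}
    (hη_zero : ∫ t, η t = 0) : ∃ φ : 𝓓(timeInterval T, ℝ), derivTestFunction φ = η := by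
  obtain ⟨a, b, ha, hb, hab⟩ := exists_tsupport_subset_Icc hT η
  have hsupp : tsupport (fun t => ∫ τ in a..t, η τ) ⊆ Icc a b :=
    tsupport_primitive_subset_Icc ((subset_tsupport η).trans hab) hη_zero
  have hderiv : ∀ t, HasDerivAt (fun t => ∫ τ in a..t, η τ) (η t) t := fun t =>
    η.continuous.integral_hasStrictDerivAt a t |>.hasDerivAt
  have hderiv_eq : deriv (fun t => ∫ τ in a..t, η τ) = η := funext fun t => (hderiv t).deriv
  refine ⟨⟨fun t => ∫ τ in a..t, η τ, ?_, ?_, ?_⟩, ?_⟩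
  · exact contDiff_infty_iff_deriv.2
      ⟨fun t => (hderiv t).differentiableAt, by rw [hderiv_eq]; exact η.contDiff⟩
  · exact isCompact_Icc.of_isClosed_subset (isClosed_tsupport _) hsupp
  · exact hsupp.trans fun t ht => ⟨ha.trans_le ht.1, ht.2.trans_lt hb⟩
  · exact DFunLike.coe_injective hderiv_eq

theorem exists_testFunction_integral_eq_one (hT : 0 < T) :
    ∃ ρ : 𝓓(timeInterval T, ℝ), ∫ t, ρ t = 1 := by
  let b : ContDiffBump (T / 2) := ⟨T / 8, T / 4, by positivity, by linarith⟩
  refine ⟨⟨b.normed volume, b.contDiff_normed, b.hasCompactSupport_normed, ?_⟩, b.integral_normed⟩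
  rw [b.tsupport_normed_eq, Real.closedBall_eq_Icc]
  exact Icc_subset_Ioo (by simp only [b]; linarith) (by simp only [b]; linarith)

theorem setIntegral_testFunction_smul (φ : 𝓓(timeInterval T, ℝ)) (z : ℝ → X) :
    ∫ t in Ioo 0 T, φ t • z t = ∫ t, φ t • z t :=
  setIntegral_eq_integral_of_forall_compl_eq_zero fun t ht => by
    rw [image_eq_zero_of_notMem_tsupport fun h => ht (φ.tsupport_subset h), zero_smul]

theorem integrable_testFunction_smul {z : ℝ → X} (hz : LocallyIntegrableOn z (Ioo 0 T))
    (φ : 𝓓(timeInterval T, ℝ)) : Integrable (fun t => φ t • z t) := by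
  obtain ⟨C, hC⟩ := φ.hasCompactSupport.exists_bound_of_continuous φ.continuous
  have hz_supp : IntegrableOn z (tsupport φ) :=
    hz.integrableOn_compact_subset φ.tsupport_subset φ.hasCompactSupport
  refine (integrableOn_iff_integrable_of_support_subset
    ((Function.support_smul_subset_left _ _).trans (subset_tsupport φ))).1 ?_
  exact Integrable.bdd_smul hz_supp C φ.continuous.aestronglyMeasurable (Eventually.of_forall hC)

theorem ae_eq_zero_of_integral_testFunction_smul_eq_zero [CompleteSpace X] {z : ℝ → X}
    (hz : LocallyIntegrableOn z (Ioo 0 T))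
    (h : ∀ φ : 𝓓(timeInterval T, ℝ), ∫ t, φ t • z t = 0) : ∀ᵐ t ∂(timeMeasure T), z t = 0 := by
  rw [timeMeasure, ae_restrict_iff' measurableSet_Ioo]
  exact isOpen_Ioo.ae_eq_zero_of_integral_contDiff_smul_eq_zero hz
    fun φ hφ hφ_compact hφ_supp => h ⟨φ, hφ, hφ_compact, hφ_supp⟩

/-- **du Bois-Reymond lemma**. -/
theorem exists_ae_eq_const_of_integral_deriv_smul_eq_zero [CompleteSpace X] (hT : 0 < T)
    {z : ℝ → X} (hz : LocallyIntegrableOn z (Ioo 0 T))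
    (h : ∀ φ : 𝓓(timeInterval T, ℝ), ∫ t, derivTestFunction φ t • z t = 0) :
    ∃ c : X, ∀ᵐ t ∂(timeMeasure T), z t = c := by
  obtain ⟨ρ, hρ⟩ := exists_testFunction_integral_eq_one hT
  refine ⟨∫ t, ρ t • z t, ?_⟩
  set c : X := ∫ t, ρ t • z t
  have hc_int : LocallyIntegrableOn (fun _ : ℝ => c) (Ioo 0 T) :=
    (locallyIntegrable_const c).locallyIntegrableOn _
  suffices ∀ᵐ t ∂(timeMeasure T), z t - c = 0 from this.mono fun t ht => sub_eq_zero.1 ht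
  refine ae_eq_zero_of_integral_testFunction_smul_eq_zero (hz.sub hc_int) fun ψ => ?_
  have integrable_coe : ∀ φ : 𝓓(timeInterval T, ℝ), Integrable φ := fun φ =>
    φ.continuous.integrable_of_hasCompactSupport φ.hasCompactSupport
  -- Subtracting the multiple of `ρ` with the same integral leaves a derivative.
  set m : ℝ := ∫ t, ψ t
  obtain ⟨φ, hφ⟩ := exists_derivTestFunction_eq hT (η := ψ - m • ρ) <| by
    simp only [sub_apply, smul_apply, smul_eq_mul]
    rw [integral_sub (integrable_coe ψ) ((integrable_coe ρ).const_mul m), integral_const_mul, hρ,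
      mul_one, sub_self]
  have hψz : ∫ t, ψ t • z t = m • c := by
    have := h φ
    simp only [hφ, sub_apply, smul_apply, smul_eq_mul, sub_smul, mul_smul] at this
    rwa [integral_sub (integrable_testFunction_smul hz ψ)
      (by exact (integrable_testFunction_smul hz ρ).smul m), integral_smul, sub_eq_zero] at this
  simp only [smul_sub]
  rw [integral_sub (integrable_testFunction_smul hz ψ) ((integrable_coe ψ).smul_const c), hψz,
    integral_smul_const, sub_self]

theorem HasWeakDeriv.integral_deriv_smul {u w : ℝ → X} (h : HasWeakDeriv T u w)
    (φ : 𝓓(timeInterval T, ℝ)) :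
    ∫ t, derivTestFunction φ t • u t = -∫ t, φ t • w t := by
  simp only [← setIntegral_testFunction_smul]
  exact h.integral_eq φ φ.contDiff φ.hasCompactSupport φ.tsupport_subset

theorem HasWeakDeriv.ae_eq [CompleteSpace X] {u w₁ w₂ : ℝ → X} (h₁ : HasWeakDeriv T u w₁)
    (h₂ : HasWeakDeriv T u w₂) : w₁ =ᵐ[timeMeasure T] w₂ := by
  suffices ∀ᵐ t ∂(timeMeasure T), w₁ t - w₂ t = 0 from this.mono fun t ht => sub_eq_zero.1 ht
  refine ae_eq_zero_of_integral_testFunction_smul_eq_zero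
    (h₁.locallyIntegrable_deriv.sub h₂.locallyIntegrable_deriv) fun φ => ?_
  simp only [smul_sub]
  rw [integral_sub (integrable_testFunction_smul h₁.locallyIntegrable_deriv φ)
    (integrable_testFunction_smul h₂.locallyIntegrable_deriv φ), sub_eq_zero, ← neg_inj,
    ← h₁.integral_deriv_smul, ← h₂.integral_deriv_smul]

theorem continuousOn_primitive_of_integrableOn_Ioo {w : ℝ → X} (hw : IntegrableOn w (Ioo 0 T)) :
    ContinuousOn (fun t => ∫ τ in 0..t, w τ) (Icc 0 T) :=
  intervalIntegral.continuousOn_primitive (by rwa [integrableOn_Icc_iff_integrableOn_Ioo]) |>.congr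
    fun t ht => intervalIntegral.integral_of_le ht.1

theorem integral_deriv_smul_primitive [CompleteSpace X] {w : ℝ → X}
    (hw : IntegrableOn w (Ioo 0 T)) (φ : 𝓓(timeInterval T, ℝ)) :
    ∫ t in Ioo 0 T, derivTestFunction φ t • ∫ τ in 0..t, w τ = -∫ t in Ioo 0 T, φ t • w t := by
  have hderiv_cont : Continuous (derivTestFunction φ) := (derivTestFunction φ).continuous
  have φ_eq_zero : φ T = 0 := image_eq_zero_of_notMem_tsupport fun h => lt_irrefl _
    (φ.tsupport_subset h).2
  calc ∫ t in Ioo 0 T, derivTestFunction φ t • ∫ τ in 0..t, w τ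
    _ = ∫ t in Ioo 0 T, derivTestFunction φ t • ∫ τ in Ioo 0 t, w τ :=
      setIntegral_congr_fun measurableSet_Ioo fun t ht => by
        rw [intervalIntegral.integral_of_le ht.1.le, integral_Ioc_eq_integral_Ioo]
    _ = ∫ τ in Ioo 0 T, (∫ t in Ioo τ T, derivTestFunction φ t) • w τ :=
      setIntegral_smul_setIntegral_Ioo
        (hderiv_cont.locallyIntegrable.integrableOn_isCompact isCompact_Icc |>.mono_set
          Ioo_subset_Icc_self) hw
    _ = ∫ τ in Ioo 0 T, -(φ τ • w τ) :=
      setIntegral_congr_fun measurableSet_Ioo fun τ hτ => by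
        rw [← integral_Ioc_eq_integral_Ioo, ← intervalIntegral.integral_of_le hτ.2.le,
          coe_derivTestFunction, intervalIntegral.integral_deriv_eq_sub
            (fun t _ => φ.contDiff.differentiable (by simp) t)
            (hderiv_cont.intervalIntegrable _ _), φ_eq_zero, zero_sub, neg_smul]
    _ = _ := integral_neg _

theorem hasWeakDeriv_of_ae_eq_primitive [CompleteSpace X] {u w : ℝ → X}
    (hw : IntegrableOn w (Ioo 0 T)) (hu : ∀ᵐ t ∂(timeMeasure T), u t = ∫ τ in 0..t, w τ) :
    HasWeakDeriv T u w where
  locallyIntegrable := IntegrableOn.locallyIntegrableOn <| Integrable.congr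
    (((continuousOn_primitive_of_integrableOn_Ioo hw).integrableOn_compact isCompact_Icc).mono_set
      Ioo_subset_Icc_self) (EventuallyEq.symm hu)
  locallyIntegrable_deriv := hw.locallyIntegrableOn
  integral_eq φ hφ hφ_compact hφ_supp :=
    (integral_congr_ae <| hu.mono fun t ht => congrArg (deriv φ t • ·) ht).trans <|
      integral_deriv_smul_primitive hw ⟨φ, hφ, hφ_compact, hφ_supp⟩

theorem vanishesAtZero_of_ae_eq_primitive {u w : ℝ → X} (hw : IntegrableOn w (Ioo 0 T))
    (hu : ∀ᵐ t ∂(timeMeasure T), u t = ∫ τ in 0..t, w τ) : VanishesAtZero T u :=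
  ⟨_, continuousOn_primitive_of_integrableOn_Ioo hw, hu, intervalIntegral.integral_same⟩

theorem HasWeakDeriv.ae_eq_primitive [CompleteSpace X] {u w : ℝ → X} (h : HasWeakDeriv T u w)
    (hT : 0 < T) (hw : IntegrableOn w (Ioo 0 T)) (h_zero : VanishesAtZero T u) :
    ∀ᵐ t ∂(timeMeasure T), u t = ∫ τ in 0..t, w τ := by
  have hP : HasWeakDeriv T (fun t => ∫ τ in 0..t, w τ) w :=
    hasWeakDeriv_of_ae_eq_primitive hw (ae_of_all _ fun _ => rfl)
  obtain ⟨c, hc⟩ := exists_ae_eq_const_of_integral_deriv_smul_eq_zero hT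
    (h.locallyIntegrable.sub hP.locallyIntegrable) fun φ => by
      simp only [Pi.sub_apply, smul_sub]
      rw [integral_sub (integrable_testFunction_smul h.locallyIntegrable (derivTestFunction φ))
        (integrable_testFunction_smul hP.locallyIntegrable (derivTestFunction φ)),
        h.integral_deriv_smul, hP.integral_deriv_smul, sub_self]
  obtain ⟨v, hv, huv, hv_zero⟩ := h_zero
  have hv_eq : EqOn v (fun t => c + ∫ τ in 0..t, w τ) (Icc 0 T) := by
    refine Measure.eqOn_Icc_of_ae_eq (μ := volume) hT.ne ?_ hv
      (continuousOn_const.add (continuousOn_primitive_of_integrableOn_Ioo hw))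
    rw [Measure.restrict_congr_set Ioo_ae_eq_Icc.symm]
    filter_upwards [hc, huv] with t hct huvt
    rw [← huvt, ← hct, Pi.sub_apply, sub_add_cancel]
  have hc_zero : c = 0 := by simpa [hv_zero] using (hv_eq (left_mem_Icc.2 hT.le)).symm
  filter_upwards [hc] with t ht
  rwa [hc_zero, Pi.sub_apply, sub_eq_zero] at ht

end WeakDerivative

section FiniteMeasure

variable {α E F : Type*} {mα : MeasurableSpace α} {μ : Measure α} [NormedAddCommGroup E]
  [NormedAddCommGroup F]

theorem aestronglyMeasurable_clm_apply {𝕜 : Type*} [NontriviallyNormedField 𝕜] [NormedSpace 𝕜 E]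
    [NormedSpace 𝕜 F] {A : α → E →L[𝕜] F} (hA : ∀ ψ, AEStronglyMeasurable (fun t => A t ψ) μ)
    {u : α → E} (hu : AEStronglyMeasurable u μ) : AEStronglyMeasurable (fun t => A t (u t)) μ := by
  obtain ⟨v, hv, huv⟩ := hu
  have simple_case (f : SimpleFunc α E) : AEStronglyMeasurable (fun t => A t (f t)) μ := by
    induction f using SimpleFunc.induction with
    | @const c S hS =>
      refine ((hA c).indicator hS).congr (Eventually.of_forall fun t => ?_)
      by_cases ht : t ∈ S <;> simp [indicator, Set.piecewise, ht]
    | add _ hf hg =>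
      exact (hf.add hg).congr (Eventually.of_forall fun t => by simp)
  have hAv : AEStronglyMeasurable (fun t => A t (v t)) μ :=
    aestronglyMeasurable_of_tendsto_ae atTop (fun n => simple_case (hv.approx n))
      (Eventually.of_forall fun t => ((A t).continuous.tendsto _).comp (hv.tendsto_approx t))
  exact hAv.congr (huv.mono fun t ht => congrArg (A t) ht.symm)

variable [IsFiniteMeasure μ] {p : ℝ≥0∞} [hp : Fact (1 ≤ p)] {β : Type*} {l : Filter β}
  {f : β → Lp E p μ} {g : Lp E p μ}

theorem tendsto_eLpNorm_one_of_tendsto_Lp (hfg : Tendsto f l (𝓝 g)) :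
    Tendsto (fun i => eLpNorm (⇑(f i) - ⇑g) 1 μ) l (𝓝 0) := by
  have exponent_nonneg : 0 ≤ 1 / (1 : ℝ≥0∞).toReal - 1 / p.toReal := by
    rcases eq_or_ne p ∞ with rfl | hp_top
    · simp
    · have : 1 ≤ p.toReal := by simpa using ENNReal.toReal_mono hp_top hp.out
      simpa using inv_le_one_of_one_le₀ this
  have h := ENNReal.Tendsto.mul_const (b := μ univ ^ (1 / (1 : ℝ≥0∞).toReal - 1 / p.toReal))
    ((Lp.tendsto_Lp_iff_tendsto_eLpNorm' _ _).1 hfg)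
    (Or.inr (ENNReal.rpow_ne_top_of_nonneg exponent_nonneg (measure_ne_top _ _)))
  rw [zero_mul] at h
  exact tendsto_of_tendsto_of_tendsto_of_le_of_le tendsto_const_nhds h (fun _ => zero_le) fun i =>
    eLpNorm_le_eLpNorm_mul_rpow_measure_univ hp.out
      ((Lp.aestronglyMeasurable _).sub (Lp.aestronglyMeasurable _))

theorem tendsto_setIntegral_of_tendsto_Lp [NormedSpace ℝ E] (hfg : Tendsto f l (𝓝 g))
    (s : Set α) : Tendsto (fun i => ∫ x in s, f i x ∂μ) l (𝓝 (∫ x in s, g x ∂μ)) :=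
  tendsto_setIntegral_of_L1' _ (Lp.aestronglyMeasurable g)
    (Eventually.of_forall fun i => (Lp.memLp (f i)).integrable hp.out)
    (tendsto_eLpNorm_one_of_tendsto_Lp hfg) s

end FiniteMeasure

instance instIsFiniteMeasureTimeMeasure (T : ℝ) : IsFiniteMeasure (timeMeasure T) := by
  unfold timeMeasure; infer_instance

theorem ae_timeMeasure_mem (T : ℝ) : ∀ᵐ t ∂(timeMeasure T), t ∈ Ioo 0 T :=
  ae_restrict_mem measurableSet_Ioo

theorem Ioc_subset_timeInterval {T t : ℝ} (ht : t ∈ Ioo 0 T) : Ioc 0 t ⊆ Ioo 0 T :=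
  fun _ hτ => ⟨hτ.1, hτ.2.trans_lt ht.2⟩

theorem intervalIntegral_eq_setIntegral_timeMeasure {X : Type*} [NormedAddCommGroup X]
    [NormedSpace ℝ X] {T t : ℝ} (ht : t ∈ Ioo 0 T) (w : ℝ → X) :
    ∫ τ in 0..t, w τ = ∫ τ in Ioc 0 t, w τ ∂(timeMeasure T) := by
  rw [intervalIntegral.integral_of_le ht.1.le, timeMeasure,
    Measure.restrict_restrict_of_subset (Ioc_subset_timeInterval ht)]

section PrimitivePair

variable {D X : Type*} [NormedAddCommGroup D] [NormedSpace ℂ D]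
  [NormedAddCommGroup X] [NormedSpace ℂ X] {ι : D →L[ℂ] X} {T : ℝ} {u u₁ u₂ : ℝ → D}
  {w w₁ w₂ : ℝ → X}

/-- Almost everywhere on `J`, `ι u` is the primitive of `w` vanishing at `0`: for integrable `w`
this says that `ι u` has distributional derivative `w` and initial value `0`. -/
def IsPrimitivePair (ι : D →L[ℂ] X) (T : ℝ) (u : ℝ → D) (w : ℝ → X) : Prop :=
  ∀ᵐ t ∂(timeMeasure T), ι (u t) = ∫ τ in 0..t, w τ

theorem IsPrimitivePair.congr (h : IsPrimitivePair ι T u₁ w₁) (hu : u₁ =ᵐ[timeMeasure T] u₂)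
    (hw : w₁ =ᵐ[timeMeasure T] w₂) : IsPrimitivePair ι T u₂ w₂ := by
  filter_upwards [h, hu, ae_timeMeasure_mem T] with t h_eq hu_eq ht
  rw [← hu_eq, h_eq, intervalIntegral_eq_setIntegral_timeMeasure ht,
    intervalIntegral_eq_setIntegral_timeMeasure ht]
  exact integral_congr_ae (ae_restrict_of_ae hw)

theorem IsPrimitivePair.add (h₁ : IsPrimitivePair ι T u₁ w₁) (h₂ : IsPrimitivePair ι T u₂ w₂)
    (hw₁ : Integrable w₁ (timeMeasure T)) (hw₂ : Integrable w₂ (timeMeasure T)) :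
    IsPrimitivePair ι T (u₁ + u₂) (w₁ + w₂) := by
  filter_upwards [h₁, h₂, ae_timeMeasure_mem T] with t h_eq₁ h_eq₂ ht
  rw [Pi.add_apply, map_add, h_eq₁, h_eq₂]
  simp only [intervalIntegral_eq_setIntegral_timeMeasure ht]
  exact (integral_add hw₁.integrableOn hw₂.integrableOn).symm

theorem IsPrimitivePair.const_smul (h : IsPrimitivePair ι T u w) (c : ℂ) :
    IsPrimitivePair ι T (c • u) (c • w) := by
  filter_upwards [h] with t h_eq
  rw [Pi.smul_apply, map_smul, h_eq]
  exact (intervalIntegral.integral_smul c w).symm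

theorem isPrimitivePair_iff [CompleteSpace X] (hT : 0 < T) (hw : Integrable w (timeMeasure T)) :
    IsPrimitivePair ι T u w ↔
      HasWeakDeriv T (fun t => ι (u t)) w ∧ VanishesAtZero T (fun t => ι (u t)) :=
  ⟨fun h => ⟨hasWeakDeriv_of_ae_eq_primitive hw h, vanishesAtZero_of_ae_eq_primitive hw h⟩,
    fun h => h.1.ae_eq_primitive hT hw h.2⟩

theorem memMR_and_solvesAE_iff [CompleteSpace X] (hT : 0 < T) {s : ℝ} (hs : 1 ≤ s)
    {A : ℝ → D →L[ℂ] X} {f : ℝ → X} :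
    MemMR ι T s u ∧ SolvesAE ι T A u f ↔
      MemLr T s u ∧ ∃ w : ℝ → X, MemLr T s w ∧ IsPrimitivePair ι T u w ∧
        ∀ᵐ t ∂(timeMeasure T), w t + A t (u t) = f t := by
  have integrable_of_memLr {w : ℝ → X} (hw : MemLr T s w) : Integrable w (timeMeasure T) :=
    MemLp.integrable (by simpa using ENNReal.ofReal_le_ofReal hs) hw
  constructor
  · rintro ⟨⟨hu, ⟨-, w, hw, hd⟩, h_zero⟩, w', hw', h_eq⟩
    refine ⟨hu, w, hw, (isPrimitivePair_iff hT (integrable_of_memLr hw)).2 ⟨hd, h_zero⟩, ?_⟩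
    filter_upwards [hd.ae_eq hw', h_eq] with t ht_eq ht
    rw [ht_eq, ht]
  · rintro ⟨hu, w, hw, hpair, h_eq⟩
    obtain ⟨hd, h_zero⟩ := (isPrimitivePair_iff hT (integrable_of_memLr hw)).1 hpair
    exact ⟨⟨hu, ⟨ι.comp_memLp' hu, w, hw, hd⟩, h_zero⟩, w, hd, h_eq⟩

end PrimitivePair

section MaxRegSpace

variable {D X : Type*} [NormedAddCommGroup D] [NormedSpace ℂ D]
  [NormedAddCommGroup X] [NormedSpace ℂ X] {ι : D →L[ℂ] X} {T : ℝ} {A : ℝ → D →L[ℂ] X}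

theorem IsAdmissible.exists_bound (hA : IsAdmissible ι T A) :
    ∃ C : ℝ, 1 ≤ C ∧ ∀ u : ℝ → D, ∀ᵐ t ∂(timeMeasure T), ‖A t (u t)‖ ≤ C * ‖u t‖ := by
  obtain ⟨C, hC⟩ := hA.bounded
  refine ⟨max 1 C, le_max_left _ _, fun u => ?_⟩
  filter_upwards [ae_timeMeasure_mem T] with t ht
  exact (A t).le_of_opNorm_le ((hC t ht).trans (le_max_right _ _)) _

theorem IsAdmissible.memLp (hA : IsAdmissible ι T A) {p : ℝ≥0∞} {u : ℝ → D}
    (hu : MemLp u p (timeMeasure T)) : MemLp (fun t => A t (u t)) p (timeMeasure T) := by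
  obtain ⟨C, -, hC⟩ := hA.exists_bound
  exact hu.of_le_mul (aestronglyMeasurable_clm_apply hA.measurable hu.1) (hC u)

variable {p : ℝ≥0∞} [hp : Fact (1 ≤ p)]

variable (p) in
/-- The superposition operator `u ↦ A(·) u(·)` from `L^p(J; D)` to `L^p(J; X)`. -/
noncomputable def superposition (hA : IsAdmissible ι T A) :
    Lp D p (timeMeasure T) →L[ℂ] Lp X p (timeMeasure T) :=
  LinearMap.mkContinuousOfExistsBound
    { toFun := fun u => (hA.memLp (Lp.memLp u)).toLp _
      map_add' := fun u v =>
        (MemLp.toLp_congr _ ((hA.memLp (Lp.memLp u)).add (hA.memLp (Lp.memLp v)))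
          ((Lp.coeFn_add u v).mono fun t ht => by
            rw [Pi.add_apply, ht, Pi.add_apply, map_add])).trans (MemLp.toLp_add _ _)
      map_smul' := fun c u =>
        (MemLp.toLp_congr _ ((hA.memLp (Lp.memLp u)).const_smul c)
          ((Lp.coeFn_smul c u).mono fun t ht => by
            rw [Pi.smul_apply, ht, Pi.smul_apply, map_smul])).trans (MemLp.toLp_const_smul _ _) }
    (by
      obtain ⟨C, -, hC⟩ := hA.exists_bound
      refine ⟨C, fun u => Lp.norm_le_mul_norm_of_ae_le_mul ?_⟩
      filter_upwards [hC u, (hA.memLp (Lp.memLp u)).coeFn_toLp] with t ht ht_eq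
      exact ht_eq ▸ ht)

theorem coeFn_superposition (hA : IsAdmissible ι T A) (u : Lp D p (timeMeasure T)) :
    superposition p hA u =ᵐ[timeMeasure T] fun t => A t (u t) :=
  (hA.memLp (Lp.memLp u)).coeFn_toLp

/-- The space `MR_0^p(J; D, X)`, realised as the space of pairs `(u, u')`. -/
noncomputable def maxRegSpace (ι : D →L[ℂ] X) (T : ℝ) (p : ℝ≥0∞) [hp : Fact (1 ≤ p)] :
    Submodule ℂ (Lp D p (timeMeasure T) × Lp X p (timeMeasure T)) where
  carrier := {x | IsPrimitivePair ι T x.1 x.2}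
  add_mem' {x y} hx hy :=
    (IsPrimitivePair.add hx hy ((Lp.memLp x.2).integrable hp.out)
      ((Lp.memLp y.2).integrable hp.out)).congr (Lp.coeFn_add x.1 y.1).symm
      (Lp.coeFn_add x.2 y.2).symm
  zero_mem' :=
    IsPrimitivePair.congr (u₁ := 0) (w₁ := 0) (by simp [IsPrimitivePair])
      (Lp.coeFn_zero D p _).symm (Lp.coeFn_zero X p _).symm
  smul_mem' c x hx :=
    (IsPrimitivePair.const_smul hx c).congr (Lp.coeFn_smul c x.1).symm (Lp.coeFn_smul c x.2).symm

theorem toLp_mem_maxRegSpace {u : ℝ → D} {w : ℝ → X} (hu : MemLp u p (timeMeasure T))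
    (hw : MemLp w p (timeMeasure T)) (h : IsPrimitivePair ι T u w) :
    (hu.toLp u, hw.toLp w) ∈ maxRegSpace ι T p :=
  h.congr hu.coeFn_toLp.symm hw.coeFn_toLp.symm

theorem isClosed_maxRegSpace :
    IsClosed (maxRegSpace ι T p : Set (Lp D p (timeMeasure T) × Lp X p (timeMeasure T))) := by
  refine isClosed_of_closure_subset fun x hx => ?_
  obtain ⟨y, hy, hyx⟩ := mem_closure_iff_seq_limit.1 hx
  have tendsto_fst : Tendsto (fun n => (y n).1) atTop (𝓝 x.1) := (continuous_fst.tendsto _).comp hyx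
  have tendsto_snd : Tendsto (fun n => (y n).2) atTop (𝓝 x.2) := (continuous_snd.tendsto _).comp hyx
  obtain ⟨k, hk, tendsto_fst_ae⟩ :=
    (tendstoInMeasure_of_tendsto_Lp tendsto_fst).exists_seq_tendsto_ae
  filter_upwards [ae_all_iff.2 hy, tendsto_fst_ae, ae_timeMeasure_mem T] with t hyt hkt ht
  have tendsto_primitive : Tendsto (fun n => ∫ τ in 0..t, (y n).2 τ) atTop
      (𝓝 (∫ τ in 0..t, x.2 τ)) := by
    simp only [intervalIntegral_eq_setIntegral_timeMeasure ht]
    exact tendsto_setIntegral_of_tendsto_Lp tendsto_snd _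
  exact tendsto_nhds_unique ((ι.continuous.tendsto _).comp hkt)
    ((tendsto_primitive.comp hk.tendsto_atTop).congr fun n => (hyt _).symm)

instance instCompleteSpaceMaxRegSpace [CompleteSpace D] [CompleteSpace X] :
    CompleteSpace (maxRegSpace ι T p) :=
  isClosed_maxRegSpace.completeSpace_coe

variable (p) in
/-- The parabolic operator `u ↦ u' + A(·) u` from `MR_0^p(J; D, X)` to `L^p(J; X)`. -/
noncomputable def parabolicOp (hA : IsAdmissible ι T A) :
    maxRegSpace ι T p →L[ℂ] Lp X p (timeMeasure T) :=
  (ContinuousLinearMap.snd ℂ _ _ + superposition p hA ∘L ContinuousLinearMap.fst ℂ _ _) ∘L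
    (maxRegSpace ι T p).subtypeL

theorem coeFn_parabolicOp (hA : IsAdmissible ι T A) (x : maxRegSpace ι T p) :
    parabolicOp p hA x =ᵐ[timeMeasure T] fun t => x.1.2 t + A t (x.1.1 t) :=
  (Lp.coeFn_add x.1.2 (superposition p hA x.1.1)).trans
    ((EventuallyEq.refl _ _).add (coeFn_superposition hA x.1.1))

theorem parabolicOp_toLp_ae_eq (hA : IsAdmissible ι T A) {u : ℝ → D} {w : ℝ → X}
    (hu : MemLp u p (timeMeasure T)) (hw : MemLp w p (timeMeasure T))
    (h : IsPrimitivePair ι T u w) :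
    parabolicOp p hA ⟨_, toLp_mem_maxRegSpace hu hw h⟩ =ᵐ[timeMeasure T]
      fun t => w t + A t (u t) := by
  filter_upwards [coeFn_parabolicOp hA ⟨_, toLp_mem_maxRegSpace hu hw h⟩, hu.coeFn_toLp,
    hw.coeFn_toLp] with t hop hut hwt
  rw [hop, hut, hwt]

theorem eq_of_fst_eq_of_parabolicOp_eq (hA : IsAdmissible ι T A) {x y : maxRegSpace ι T p}
    (hfst : x.1.1 = y.1.1) (hop : parabolicOp p hA x = parabolicOp p hA y) : x = y := by
  refine Subtype.ext (Prod.ext hfst (Lp.ext ?_))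
  filter_upwards [coeFn_parabolicOp hA x, coeFn_parabolicOp hA y] with t hx hy
  rw [hop, hy, hfst] at hx
  exact (add_right_cancel hx).symm

variable [CompleteSpace X] {s : ℝ}

theorem memMR_and_solvesAE_fst [Fact (1 ≤ ENNReal.ofReal s)] (hT : 0 < T) (hs : 1 ≤ s)
    (hA : IsAdmissible ι T A) {x : maxRegSpace ι T (ENNReal.ofReal s)} {f : ℝ → X}
    (hf : parabolicOp _ hA x =ᵐ[timeMeasure T] f) :
    MemMR ι T s x.1.1 ∧ SolvesAE ι T A x.1.1 f :=
  (memMR_and_solvesAE_iff hT hs).2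
    ⟨Lp.memLp _, x.1.2, Lp.memLp _, x.2, (coeFn_parabolicOp hA x).symm.trans hf⟩

theorem exists_maxRegSpace_parabolicOp_ae_eq [Fact (1 ≤ ENNReal.ofReal s)] (hT : 0 < T)
    (hs : 1 ≤ s) (hA : IsAdmissible ι T A) {u : ℝ → D} {f : ℝ → X}
    (h : MemMR ι T s u ∧ SolvesAE ι T A u f) :
    ∃ x : maxRegSpace ι T (ENNReal.ofReal s), x.1.1 =ᵐ[timeMeasure T] u ∧
      parabolicOp _ hA x =ᵐ[timeMeasure T] f := by
  obtain ⟨hu, w, hw, hpair, h_eq⟩ := (memMR_and_solvesAE_iff hT hs).1 h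
  exact ⟨⟨_, toLp_mem_maxRegSpace hu hw hpair⟩, hu.coeFn_toLp,
    (parabolicOp_toLp_ae_eq hA hu hw hpair).trans h_eq⟩

theorem HasMaxReg.bijective_parabolicOp [Fact (1 ≤ ENNReal.ofReal s)] (h : HasMaxReg ι T s A)
    (hT : 0 < T) (hs : 1 ≤ s) :
    Function.Bijective (parabolicOp (ENNReal.ofReal s) h.admissible) := by
  refine ⟨fun x y hxy => ?_, fun g => ?_⟩
  · obtain ⟨u, -, hu⟩ := h.exists_unique (parabolicOp _ h.admissible y) (Lp.memLp _)
    have hx := hu _ (memMR_and_solvesAE_fst hT hs h.admissible (by rw [hxy]))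
    have hy := hu _ (memMR_and_solvesAE_fst hT hs h.admissible EventuallyEq.rfl)
    exact eq_of_fst_eq_of_parabolicOp_eq h.admissible (Lp.ext (hx.trans hy.symm)) hxy
  · obtain ⟨u, hu, -⟩ := h.exists_unique g (Lp.memLp g)
    obtain ⟨x, -, hx⟩ := exists_maxRegSpace_parabolicOp_ae_eq hT hs h.admissible hu
    exact ⟨x, Lp.ext hx⟩

theorem hasMaxReg_of_bijective_parabolicOp [Fact (1 ≤ ENNReal.ofReal s)] (hT : 0 < T)
    (hs : 1 ≤ s) (hA : IsAdmissible ι T A)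
    (h : Function.Bijective (parabolicOp (ENNReal.ofReal s) hA)) : HasMaxReg ι T s A := by
  refine ⟨hA, fun f hf => ?_⟩
  obtain ⟨x, hx⟩ := h.2 (MemLp.toLp f hf)
  have hxf : parabolicOp _ hA x =ᵐ[timeMeasure T] f := hx ▸ MemLp.coeFn_toLp hf
  refine ⟨x.1.1, memMR_and_solvesAE_fst hT hs hA hxf, fun v hv => ?_⟩
  obtain ⟨y, hyv, hyf⟩ := exists_maxRegSpace_parabolicOp_ae_eq hT hs hA hv
  have hyx : y = x := h.1 (Lp.ext (hyf.trans hxf.symm))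
  exact hyx ▸ hyv.symm

end MaxRegSpace

section MaximalFunction

/-- The set where the uncentred maximal function of `h` exceeds `l`. -/
def maximalSet (h : ℝ → ℝ) (l : ℝ) : Set ℝ :=
  ⋃ q ∈ {q : ℝ × ℝ | 0 < q.2 ∧ l * (2 * q.2) < ∫ t in Metric.ball q.1 q.2, h t},
    Metric.ball q.1 q.2

variable {h : ℝ → ℝ} {l : ℝ}

theorem isOpen_maximalSet (h : ℝ → ℝ) (l : ℝ) : IsOpen (maximalSet h l) :=
  isOpen_biUnion fun _ _ => Metric.isOpen_ball

theorem setIntegral_ball_le_of_notMem_maximalSet {t c ρ : ℝ} (ht : t ∉ maximalSet h l)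
    (hρ : 0 < ρ) (htc : t ∈ Metric.ball c ρ) : ∫ τ in Metric.ball c ρ, h τ ≤ l * (2 * ρ) := by
  by_contra hlt
  exact ht (mem_biUnion (x := (c, ρ)) ⟨hρ, not_le.1 hlt⟩ htc)

theorem ae_le_of_notMem_maximalSet (hh : Integrable h) (l : ℝ) :
    ∀ᵐ t : ℝ, t ∉ maximalSet h l → h t ≤ l := by
  filter_upwards [IsUnifLocDoublingMeasure.ae_tendsto_average volume hh.locallyIntegrable 1]
    with t h_lebesgue ht
  have tendsto_average := h_lebesgue (fun _ => t) (fun δ => δ) (tendsto_id (α := ℝ)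
    (x := 𝓝[>] 0)) (by
      filter_upwards [self_mem_nhdsWithin] with δ hδ
      exact Metric.mem_closedBall_self (by rw [one_mul]; exact (mem_Ioi.1 hδ).le))
  refine le_of_tendsto tendsto_average ?_
  filter_upwards [self_mem_nhdsWithin] with δ hδ
  have hδ : 0 < δ := hδ
  rw [setAverage_eq, Measure.real, Real.volume_closedBall, ENNReal.toReal_ofReal (by positivity),
    smul_eq_mul, inv_mul_le_iff₀ (by positivity), mul_comm, Real.closedBall_eq_Icc,
    integral_Icc_eq_integral_Ioo, ← Real.ball_eq_Ioo]
  exact setIntegral_ball_le_of_notMem_maximalSet ht hδ (Metric.mem_ball_self hδ)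

theorem exists_disjoint_balls_maximalSet_subset (hh : Integrable h) (h_nonneg : 0 ≤ h)
    (hl : 0 < l) :
    ∃ U : Set (ℝ × ℝ), U.Countable ∧ U.PairwiseDisjoint (fun q => Metric.ball q.1 q.2) ∧
      (∀ q ∈ U, l * (2 * q.2) < ∫ t in Metric.ball q.1 q.2, h t) ∧
      maximalSet h l ⊆ ⋃ q ∈ U, Metric.ball q.1 (5 * q.2) := by
  set Q : Set (ℝ × ℝ) := {q | 0 < q.2 ∧ l * (2 * q.2) < ∫ t in Metric.ball q.1 q.2, h t}
  have radius_le : ∀ q ∈ Q, q.2 ≤ (∫ t, h t) / l := by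
    intro q hq
    rw [le_div_iff₀ hl]
    have : ∫ t in Metric.ball q.1 q.2, h t ≤ ∫ t, h t :=
      setIntegral_le_integral hh (Eventually.of_forall h_nonneg)
    nlinarith [hq.1, hq.2]
  obtain ⟨U, hUQ, hU_disj, hU_cover⟩ := Vitali.exists_disjoint_subfamily_covering_enlargement_ball
    Q (fun q => q.1) (fun q => q.2) _ radius_le 5 (by norm_num)
  refine ⟨U, hU_disj.countable_of_isOpen (fun _ _ => Metric.isOpen_ball)
    (fun q hq => Metric.nonempty_ball.2 (hUQ hq).1), hU_disj, fun q hq => (hUQ hq).2,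
    iUnion₂_subset fun q hq => ?_⟩
  obtain ⟨b, hb, hqb⟩ := hU_cover q hq
  exact hqb.trans (subset_biUnion_of_mem (u := fun q : ℝ × ℝ => Metric.ball q.1 (5 * q.2)) hb)

theorem exists_volume_maximalSet_le (hh : Integrable h) (h_nonneg : 0 ≤ h) (hl : 0 < l) :
    ∃ V : Set ℝ, volume (maximalSet h l) ≤ 5 * volume V ∧
      ENNReal.ofReal l * volume V ≤ ∫⁻ t in V, ENNReal.ofReal (h t) := by
  obtain ⟨U, hU, hU_disj, hU_avg, hU_cover⟩ :=
    exists_disjoint_balls_maximalSet_subset hh h_nonneg hl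
  have volume_eq : volume (⋃ q ∈ U, Metric.ball q.1 q.2) =
      ∑' q : U, ENNReal.ofReal (2 * q.1.2) := by
    rw [measure_biUnion hU hU_disj fun _ _ => measurableSet_ball]
    simp only [Real.volume_ball]
  refine ⟨⋃ q ∈ U, Metric.ball q.1 q.2, ?_, ?_⟩
  · refine (measure_mono hU_cover).trans ((measure_biUnion_le _ hU _).trans_eq ?_)
    rw [volume_eq, ← ENNReal.tsum_mul_left]
    refine tsum_congr fun q => ?_
    rw [Real.volume_ball, ← ENNReal.ofReal_ofNat 5, ← ENNReal.ofReal_mul (by norm_num),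
      mul_left_comm]
  · rw [volume_eq, lintegral_biUnion hU (fun _ _ => measurableSet_ball) hU_disj,
      ← ENNReal.tsum_mul_left]
    refine ENNReal.tsum_le_tsum fun q => ?_
    rw [← ENNReal.ofReal_mul hl.le, ← ofReal_integral_eq_lintegral_ofReal hh.integrableOn
      (Eventually.of_forall h_nonneg)]
    exact ENNReal.ofReal_le_ofReal (hU_avg q q.2).le

theorem ofReal_half_mul_measure_le {α : Type*} {mα : MeasurableSpace α} {μ : Measure α}
    {f : α → ℝ} (hf : Integrable f μ) (hl : 0 < l) {V : Set α}
    (hV : ENNReal.ofReal l * μ V ≤ ∫⁻ x in V, ENNReal.ofReal (f x) ∂μ) :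
    ENNReal.ofReal (l / 2) * μ V ≤ ∫⁻ x in {x | l / 2 < f x}, ENNReal.ofReal (f x) ∂μ := by
  have le_indicator_add (x : α) : ENNReal.ofReal (f x) ≤
      {x | l / 2 < f x}.indicator (fun x => ENNReal.ofReal (f x)) x + ENNReal.ofReal (l / 2) := by
    by_cases hx : l / 2 < f x
    · rw [indicator_of_mem (show x ∈ {x | l / 2 < f x} from hx)]
      exact le_self_add
    · exact (ENNReal.ofReal_le_ofReal (not_lt.1 hx)).trans le_add_self
  have measurable_superlevel : NullMeasurableSet {x | l / 2 < f x} μ :=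
    nullMeasurableSet_lt aemeasurable_const hf.aemeasurable
  have setLIntegral_le : ∫⁻ x in V, ENNReal.ofReal (f x) ∂μ ≤
      (∫⁻ x in {x | l / 2 < f x}, ENNReal.ofReal (f x) ∂μ) + ENNReal.ofReal (l / 2) * μ V := by
    refine (lintegral_mono le_indicator_add).trans ?_
    rw [lintegral_add_right _ measurable_const, setLIntegral_const,
      ← lintegral_indicator₀ measurable_superlevel]
    gcongr
    exact Measure.restrict_le_self
  have measure_ne_top : ENNReal.ofReal (l / 2) * μ V ≠ ⊤ := by
    refine ENNReal.mul_ne_top ENNReal.ofReal_ne_top fun h_top => ?_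
    rw [h_top, ENNReal.mul_top (by simpa using hl), top_le_iff] at hV
    exact ((setLIntegral_le_lintegral _ _).trans_lt hf.lintegral_lt_top).ne hV
  refine (ENNReal.add_le_add_iff_right measure_ne_top).1 ?_
  rw [← add_mul, ← ENNReal.ofReal_add (by positivity) (by positivity), add_halves]
  exact hV.trans setLIntegral_le

theorem volume_maximalSet_le (hh : Integrable h) (h_nonneg : 0 ≤ h) (hl : 0 < l) :
    volume (maximalSet h l) ≤
      ENNReal.ofReal (10 / l) * ∫⁻ t in {t | l / 2 < h t}, ENNReal.ofReal (h t) := by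
  obtain ⟨V, hV, hVh⟩ := exists_volume_maximalSet_le hh h_nonneg hl
  calc volume (maximalSet h l) ≤ 5 * volume V := hV
    _ = ENNReal.ofReal (10 / l) * (ENNReal.ofReal (l / 2) * volume V) := by
        rw [← mul_assoc, ← ENNReal.ofReal_mul (by positivity),
          show 10 / l * (l / 2) = 5 by field_simp; norm_num, ENNReal.ofReal_ofNat]
    _ ≤ _ := by
        gcongr
        exact ofReal_half_mul_measure_le hh hl hVh

end MaximalFunction

section ChangeOfVariables

theorem measurePreserving_withDensity_orderIso (y : ℝ ≃o ℝ) {y' : ℝ → ℝ}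
    (hi : ∀ a b, IntervalIntegrable y' volume a b) (h_nonneg : 0 ≤ y')
    (hy : ∀ a b, ∫ t in a..b, y' t = y b - y a) :
    MeasurePreserving y (volume.withDensity fun t => ENNReal.ofReal (y' t)) volume := by
  refine ⟨y.continuous.measurable, (Real.measure_ext_Ioo_rat fun a b => ?_).symm⟩
  rw [Measure.map_apply y.continuous.measurable measurableSet_Ioo, y.preimage_Ioo,
    withDensity_apply _ measurableSet_Ioo, Real.volume_Ioo]
  rcases le_or_gt (a : ℝ) b with hab | hab
  · have hab' : y.symm a ≤ y.symm b := y.symm.monotone hab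
    rw [← ofReal_integral_eq_lintegral_ofReal
        (((intervalIntegrable_iff_integrableOn_Ioc_of_le hab').1 (hi _ _)).mono_set
          Ioo_subset_Ioc_self) (Eventually.of_forall h_nonneg),
      ← integral_Ioc_eq_integral_Ioo, ← intervalIntegral.integral_of_le hab', hy,
      y.apply_symm_apply, y.apply_symm_apply]
  · rw [Ioo_eq_empty (by simpa using hab.le), ENNReal.ofReal_of_nonpos (sub_nonpos.2 hab.le)]
    simp

variable {y : ℝ ≃o ℝ} {y' : ℝ → ℝ}

theorem lintegral_ofReal_mul_comp_orderIso (hm : Measurable y')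
    (hy : MeasurePreserving y (volume.withDensity fun t => ENNReal.ofReal (y' t)) volume)
    {f : ℝ → ℝ≥0∞} (hf : Measurable f) :
    ∫⁻ t, ENNReal.ofReal (y' t) * f (y t) = ∫⁻ t, f t := by
  rw [← hy.lintegral_comp hf]
  exact (lintegral_withDensity_eq_lintegral_mul _ hm.ennreal_ofReal (hf.comp hy.measurable)).symm

theorem setIntegral_Iic_smul_comp_orderIso {E : Type*} [NormedAddCommGroup E] [NormedSpace ℝ E]
    (hm : Measurable y') (h_nonneg : 0 ≤ y')
    (hy : MeasurePreserving y (volume.withDensity fun t => ENNReal.ofReal (y' t)) volume)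
    (f : ℝ → E) (c : ℝ) : ∫ t in Iic c, y' t • f (y t) = ∫ t in Iic (y c), f t := by
  rw [← hy.setIntegral_preimage_emb y.toHomeomorph.measurableEmbedding f, y.preimage_Iic,
    y.symm_apply_apply, setIntegral_withDensity_eq_setIntegral_toReal_smul hm.ennreal_ofReal
      (Eventually.of_forall fun _ => ENNReal.ofReal_lt_top) _ measurableSet_Iic]
  simp only [ENNReal.toReal_ofReal (h_nonneg _)]

end ChangeOfVariables

section LipschitzPerturbation

variable {g : ℝ → ℝ} {K : ℝ≥0}

theorem strictMono_sub_of_lipschitzWith (hg : LipschitzWith K g) (hK : K < 1) :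
    StrictMono fun t => t - g t := by
  intro s t hst
  have h_dist : g t - g s ≤ K * (t - s) := by
    simpa [Real.dist_eq, abs_of_pos (sub_pos.2 hst)] using
      (le_abs_self _).trans (hg.dist_le_mul t s)
  have : K * (t - s) < 1 * (t - s) :=
    mul_lt_mul_of_pos_right (NNReal.coe_lt_one.2 hK) (sub_pos.2 hst)
  simp only
  linarith

theorem surjective_sub_of_lipschitzWith (hg : LipschitzWith K g) (hK : K < 1) :
    Function.Surjective fun t => t - g t := fun c => by
  have contracting : ContractingWith K fun t => c + g t :=
    ⟨hK, LipschitzWith.of_dist_le_mul fun s t => by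
      simpa only [dist_add_left] using hg.dist_le_mul s t⟩
  exact ⟨_, sub_eq_iff_eq_add.2 contracting.fixedPoint_isFixedPt.symm⟩

theorem intervalIntegrable_deriv_of_lipschitzWith (hg : LipschitzWith K g) (a b : ℝ) :
    IntervalIntegrable (deriv g) volume a b :=
  (intervalIntegrable_const (c := (K : ℝ))).mono_fun (measurable_deriv g).aestronglyMeasurable
    (Eventually.of_forall fun t => by simpa using norm_deriv_le_of_lipschitz hg (x₀ := t))

theorem abs_deriv_le_of_lipschitzWith (hg : LipschitzWith K g) (t : ℝ) : |deriv g t| ≤ K :=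
  norm_deriv_le_of_lipschitz hg

theorem exists_orderIso_sub_measurePreserving (hg : LipschitzWith K g) (hK : K < 1) :
    ∃ y : ℝ ≃o ℝ, (∀ t, y t = t - g t) ∧
      MeasurePreserving y (volume.withDensity fun t => ENNReal.ofReal (1 - deriv g t)) volume := by
  let y : ℝ ≃o ℝ := (strictMono_sub_of_lipschitzWith hg hK).orderIsoOfSurjective _
    (surjective_sub_of_lipschitzWith hg hK)
  have deriv_integrable := intervalIntegrable_deriv_of_lipschitzWith hg
  refine ⟨y, fun t => rfl, measurePreserving_withDensity_orderIso y
    (fun a b => intervalIntegrable_const.sub (deriv_integrable a b)) (fun t => ?_) fun a b => ?_⟩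
  · exact sub_nonneg.2 (((le_abs_self _).trans (abs_deriv_le_of_lipschitzWith hg t)).trans
      (NNReal.coe_le_one.2 hK.le))
  · rw [intervalIntegral.integral_sub intervalIntegrable_const (deriv_integrable a b),
      (hg.lipschitzOnWith (s := uIcc a b)).absolutelyContinuousOnInterval.integral_deriv_eq_sub,
      intervalIntegral.integral_const, smul_eq_mul, mul_one]
    exact sub_sub_sub_comm b a (g b) (g a)

end LipschitzPerturbation

section Smoothing

variable {ρ : ℝ → ℝ} {E : Type*} [NormedAddCommGroup E]

theorem lipschitzWith_half_const_mul (hρ : LipschitzWith (1 / 2) ρ) {σ : ℝ}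
    (hσ : σ ∈ Ioo (0 : ℝ) 1) : LipschitzWith (1 / 2) fun t => σ * ρ t :=
  LipschitzWith.of_dist_le_mul fun s t => by
    rw [Real.dist_eq, ← mul_sub, abs_mul, abs_of_pos hσ.1]
    exact (mul_le_of_le_one_left (abs_nonneg _) hσ.2.le).trans (hρ.dist_le_mul s t)

theorem one_sub_mul_deriv_mem_Icc (hρ : LipschitzWith (1 / 2) ρ) {σ : ℝ}
    (hσ : σ ∈ Ioo (0 : ℝ) 1) (t : ℝ) : 1 - σ * deriv ρ t ∈ Icc (0 : ℝ) (3 / 2) := by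
  have h_abs := abs_deriv_le_of_lipschitzWith (lipschitzWith_half_const_mul hρ hσ) t
  rw [deriv_const_mul_field, NNReal.coe_div, NNReal.coe_one, NNReal.coe_ofNat, abs_le] at h_abs
  constructor <;> linarith [h_abs.1, h_abs.2]

theorem exists_orderIso_sub_mul (hρ : LipschitzWith (1 / 2) ρ) {σ : ℝ} (hσ : σ ∈ Ioo (0 : ℝ) 1) :
    ∃ y : ℝ ≃o ℝ, (∀ t, y t = t - σ * ρ t) ∧
      MeasurePreserving y (volume.withDensity fun t => ENNReal.ofReal (1 - σ * deriv ρ t))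
        volume := by
  simpa only [deriv_const_mul_field] using exists_orderIso_sub_measurePreserving
    (lipschitzWith_half_const_mul hρ hσ) (by rw [← NNReal.coe_lt_coe]; norm_num)

theorem measurable_sub_mul (hρ : LipschitzWith (1 / 2) ρ) :
    Measurable fun p : ℝ × ℝ => p.1 - p.2 * ρ p.1 :=
  measurable_fst.sub (measurable_snd.mul (hρ.continuous.measurable.comp measurable_fst))

theorem measurable_one_sub_mul_deriv (ρ : ℝ → ℝ) :
    Measurable fun p : ℝ × ℝ => 1 - p.2 * deriv ρ p.1 :=
  measurable_const.sub (measurable_snd.mul ((measurable_deriv ρ).comp measurable_fst))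

theorem integrable_comp_sub_mul {u : ℝ → E} (hu : Integrable u) (t : ℝ) {δ : ℝ} (hδ : δ ≠ 0) :
    Integrable fun σ => u (t - σ * δ) :=
  (hu.comp_sub_left t).comp_mul_right' hδ

variable [NormedSpace ℝ E]

theorem setIntegral_comp_sub_mul (u : ℝ → E) (t : ℝ) {δ : ℝ} (hδ : 0 < δ) :
    ∫ σ in Ioo (0 : ℝ) 1, u (t - σ * δ) = δ⁻¹ • ∫ τ in Ioc (t - δ) t, u τ := by
  rw [← integral_Ioc_eq_integral_Ioo, ← intervalIntegral.integral_of_le zero_le_one,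
    ← intervalIntegral.integral_of_le (by linarith)]
  simp only [mul_comm _ δ]
  rw [intervalIntegral.integral_comp_sub_mul u hδ.ne', mul_one, mul_zero, sub_zero]

/-- The average of `u` over the interval `(t - ρ t, t)`, with value `u t` where `ρ t = 0`. -/
noncomputable def smoothing (ρ : ℝ → ℝ) (u : ℝ → E) (t : ℝ) : E :=
  ∫ σ in Ioo (0 : ℝ) 1, u (t - σ * ρ t)

/-- The derivative of `smoothing ρ u` when `u` is a primitive of `w`. -/
noncomputable def smoothingDeriv (ρ : ℝ → ℝ) (w : ℝ → E) (t : ℝ) : E :=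
  ∫ σ in Ioo (0 : ℝ) 1, (1 - σ * deriv ρ t) • w (t - σ * ρ t)

theorem stronglyMeasurable_smoothing (hρ : LipschitzWith (1 / 2) ρ) {u : ℝ → E}
    (hu : StronglyMeasurable u) : StronglyMeasurable (smoothing ρ u) :=
  StronglyMeasurable.integral_prod_right (f := fun t σ => u (t - σ * ρ t))
    (hu.comp_measurable (measurable_sub_mul hρ))

theorem stronglyMeasurable_smoothingDeriv_kernel (hρ : LipschitzWith (1 / 2) ρ) {w : ℝ → E}
    (hw : StronglyMeasurable w) :
    StronglyMeasurable fun p : ℝ × ℝ => (1 - p.2 * deriv ρ p.1) • w (p.1 - p.2 * ρ p.1) :=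
  (measurable_one_sub_mul_deriv ρ).stronglyMeasurable.smul
    (hw.comp_measurable (measurable_sub_mul hρ))

theorem stronglyMeasurable_smoothingDeriv (hρ : LipschitzWith (1 / 2) ρ) {w : ℝ → E}
    (hw : StronglyMeasurable w) : StronglyMeasurable (smoothingDeriv ρ w) :=
  StronglyMeasurable.integral_prod_right
    (f := fun t σ => (1 - σ * deriv ρ t) • w (t - σ * ρ t))
    (stronglyMeasurable_smoothingDeriv_kernel hρ hw)

theorem lintegral_enorm_smoothingDeriv_kernel (hρ : LipschitzWith (1 / 2) ρ) {w : ℝ → E}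
    (hw : StronglyMeasurable w) {σ : ℝ} (hσ : σ ∈ Ioo (0 : ℝ) 1) :
    ∫⁻ t, ‖(1 - σ * deriv ρ t) • w (t - σ * ρ t)‖ₑ = ∫⁻ t, ‖w t‖ₑ := by
  obtain ⟨y, hy, hy_preserving⟩ := exists_orderIso_sub_mul hρ hσ
  rw [← lintegral_ofReal_mul_comp_orderIso (y' := fun t => 1 - σ * deriv ρ t)
    ((measurable_one_sub_mul_deriv ρ).comp measurable_prodMk_right) hy_preserving hw.enorm]
  refine lintegral_congr fun t => ?_
  rw [enorm_smul, hy, Real.enorm_of_nonneg (one_sub_mul_deriv_mem_Icc hρ hσ t).1]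

theorem integrable_smoothingDeriv_kernel (hρ : LipschitzWith (1 / 2) ρ) {w : ℝ → E}
    (hwm : StronglyMeasurable w) (hw : Integrable w) :
    Integrable (fun p : ℝ × ℝ => (1 - p.2 * deriv ρ p.1) • w (p.1 - p.2 * ρ p.1))
      ((volume : Measure ℝ).prod (volume.restrict (Ioo 0 1))) := by
  have kernel_measurable := stronglyMeasurable_smoothingDeriv_kernel hρ hwm
  refine ⟨kernel_measurable.aestronglyMeasurable, ?_⟩
  rw [hasFiniteIntegral_iff_enorm, lintegral_prod_symm _ kernel_measurable.enorm.aemeasurable,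
    setLIntegral_congr_fun measurableSet_Ioo fun σ hσ =>
      lintegral_enorm_smoothingDeriv_kernel hρ hwm hσ, setLIntegral_const]
  exact ENNReal.mul_lt_top hw.hasFiniteIntegral (by simp)

theorem integrable_smoothingDeriv (hρ : LipschitzWith (1 / 2) ρ) {w : ℝ → E}
    (hwm : StronglyMeasurable w) (hw : Integrable w) : Integrable (smoothingDeriv ρ w) :=
  (integrable_smoothingDeriv_kernel hρ hwm hw).integral_prod_left

theorem setIntegral_Iic_smoothingDeriv (hρ : LipschitzWith (1 / 2) ρ) {w : ℝ → E}
    (hwm : StronglyMeasurable w) (hw : Integrable w) (t : ℝ) :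
    ∫ τ in Iic t, smoothingDeriv ρ w τ = smoothing ρ (fun t => ∫ τ in Iic t, w τ) t := by
  unfold smoothingDeriv smoothing
  rw [integral_integral_swap ((integrable_smoothingDeriv_kernel hρ hwm hw).mono_measure
    (Measure.prod_mono Measure.restrict_le_self le_rfl))]
  refine setIntegral_congr_fun measurableSet_Ioo fun σ hσ => ?_
  obtain ⟨y, hy, hy_preserving⟩ := exists_orderIso_sub_mul hρ hσ
  simpa only [hy] using setIntegral_Iic_smul_comp_orderIso
    (y' := fun t => 1 - σ * deriv ρ t)
    ((measurable_one_sub_mul_deriv ρ).comp measurable_prodMk_right)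
    (fun t => (one_sub_mul_deriv_mem_Icc hρ hσ t).1) hy_preserving w t

variable [CompleteSpace E]

theorem smoothing_of_eq_zero (u : ℝ → E) {t : ℝ} (ht : ρ t = 0) : smoothing ρ u t = u t := by
  simp [smoothing, ht]

theorem smoothingDeriv_of_eq_zero (hρ : 0 ≤ ρ) (w : ℝ → E) {t : ℝ} (ht : ρ t = 0) :
    smoothingDeriv ρ w t = w t := by
  have : deriv ρ t = 0 := IsLocalMin.deriv_eq_zero
    (Eventually.of_forall fun s => by rw [ht]; exact hρ s)
  simp [smoothingDeriv, ht, this]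

end Smoothing

section SmoothingRadius

variable {h : ℝ → ℝ} {l t : ℝ}

/-- Half the distance to the complement of the set where the maximal function exceeds `l`: the
length of the interval over which a function dominated by `h` is averaged at level `l`. -/
noncomputable def smoothingRadius (h : ℝ → ℝ) (l t : ℝ) : ℝ :=
  1 / 2 * Metric.infDist t (maximalSet h l)ᶜ

theorem lipschitzWith_smoothingRadius (h : ℝ → ℝ) (l : ℝ) :
    LipschitzWith (1 / 2) (smoothingRadius h l) :=
  LipschitzWith.of_dist_le_mul fun s t => by
    rw [Real.dist_eq, smoothingRadius, smoothingRadius, ← mul_sub, abs_mul]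
    simpa [Real.dist_eq] using (Metric.lipschitz_infDist_pt (maximalSet h l)ᶜ).dist_le_mul s t

theorem smoothingRadius_nonneg (h : ℝ → ℝ) (l : ℝ) : 0 ≤ smoothingRadius h l :=
  fun _ => mul_nonneg (by norm_num) Metric.infDist_nonneg

theorem smoothingRadius_eq_zero (ht : t ∉ maximalSet h l) : smoothingRadius h l t = 0 := by
  rw [smoothingRadius, Metric.infDist_zero_of_mem ht, mul_zero]

theorem compl_maximalSet_nonempty (hh : Integrable h) (h_nonneg : 0 ≤ h) (hl : 0 < l) :
    (maximalSet h l)ᶜ.Nonempty := by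
  rw [nonempty_compl]
  intro h_univ
  have h_top := volume_maximalSet_le hh h_nonneg hl
  rw [h_univ, Real.volume_univ, top_le_iff] at h_top
  exact ENNReal.mul_ne_top ENNReal.ofReal_ne_top
    ((setLIntegral_le_lintegral _ _).trans_lt hh.lintegral_lt_top).ne h_top

theorem exists_notMem_maximalSet_dist_eq (hh : Integrable h) (h_nonneg : 0 ≤ h) (hl : 0 < l)
    (t : ℝ) : ∃ z ∉ maximalSet h l, dist t z = 2 * smoothingRadius h l t := by
  obtain ⟨z, hz, hz_dist⟩ := (isOpen_maximalSet h l).isClosed_compl.exists_infDist_eq_dist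
    (compl_maximalSet_nonempty hh h_nonneg hl) t
  exact ⟨z, hz, by rw [smoothingRadius, hz_dist]; ring⟩

theorem smoothingRadius_pos (hh : Integrable h) (h_nonneg : 0 ≤ h) (hl : 0 < l)
    (ht : t ∈ maximalSet h l) : 0 < smoothingRadius h l t := by
  obtain ⟨z, hz, hz_dist⟩ := exists_notMem_maximalSet_dist_eq hh h_nonneg hl t
  have : 0 < dist t z := dist_pos.2 fun h_eq => hz (h_eq ▸ ht)
  linarith

theorem setIntegral_smoothingRadius_le (hh : Integrable h) (h_nonneg : 0 ≤ h) (hl : 0 < l)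
    (ht : t ∈ maximalSet h l) :
    ∫ σ in Ioo (0 : ℝ) 1, h (t - σ * smoothingRadius h l t) ≤ 8 * l := by
  have hδ := smoothingRadius_pos hh h_nonneg hl ht
  obtain ⟨z, hz, hz_dist⟩ := exists_notMem_maximalSet_dist_eq hh h_nonneg hl t
  set δ := smoothingRadius h l t
  have Ioc_subset_ball : Ioc (t - δ) t ⊆ Metric.ball z (4 * δ) := by
    intro τ hτ
    have := abs_le.1 (Real.dist_eq t z ▸ hz_dist.le)
    rw [Metric.mem_ball, Real.dist_eq, abs_lt]
    constructor <;> linarith [hτ.1, hτ.2, this.1, this.2]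
  rw [setIntegral_comp_sub_mul h t hδ, smul_eq_mul, inv_mul_le_iff₀ hδ]
  calc ∫ τ in Ioc (t - δ) t, h τ
      ≤ ∫ τ in Metric.ball z (4 * δ), h τ :=
        setIntegral_mono_set hh.integrableOn (Eventually.of_forall h_nonneg)
          Ioc_subset_ball.eventuallyLE
    _ ≤ l * (2 * (4 * δ)) := setIntegral_ball_le_of_notMem_maximalSet hz (by positivity)
        (Metric.mem_ball_self (by positivity))
    _ = δ * (8 * l) := by ring

variable {E : Type*} [NormedAddCommGroup E] [NormedSpace ℝ E] {u : ℝ → E}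

theorem norm_smoothing_le (hh : Integrable h) (huh : ∀ t, ‖u t‖ ≤ h t) (hl : 0 < l)
    (ht : t ∈ maximalSet h l) : ‖smoothing (smoothingRadius h l) u t‖ ≤ 8 * l := by
  have h_nonneg : 0 ≤ h := fun t => (norm_nonneg _).trans (huh t)
  have hδ := smoothingRadius_pos hh h_nonneg hl ht
  exact (norm_integral_le_of_norm_le (integrable_comp_sub_mul hh t hδ.ne').integrableOn
    (Eventually.of_forall fun σ => huh _)).trans (setIntegral_smoothingRadius_le hh h_nonneg hl ht)

theorem norm_smoothingDeriv_le (hh : Integrable h) (huh : ∀ t, ‖u t‖ ≤ h t) (hl : 0 < l)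
    (ht : t ∈ maximalSet h l) : ‖smoothingDeriv (smoothingRadius h l) u t‖ ≤ 12 * l := by
  have h_nonneg : 0 ≤ h := fun t => (norm_nonneg _).trans (huh t)
  have hδ := smoothingRadius_pos hh h_nonneg hl ht
  calc ‖smoothingDeriv (smoothingRadius h l) u t‖
      ≤ ∫ σ in Ioo (0 : ℝ) 1, 3 / 2 * h (t - σ * smoothingRadius h l t) := by
        refine norm_integral_le_of_norm_le
          ((integrable_comp_sub_mul hh t hδ.ne').integrableOn.const_mul _) ?_
        filter_upwards [ae_restrict_mem measurableSet_Ioo] with σ hσ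
        obtain ⟨factor_nonneg, factor_le⟩ :=
          one_sub_mul_deriv_mem_Icc (lipschitzWith_smoothingRadius h l) hσ t
        rw [norm_smul, Real.norm_of_nonneg factor_nonneg]
        exact mul_le_mul factor_le (huh _) (norm_nonneg _) (by norm_num)
    _ = 3 / 2 * ∫ σ in Ioo (0 : ℝ) 1, h (t - σ * smoothingRadius h l t) :=
        integral_const_mul _ _
    _ ≤ 12 * l := by linarith [setIntegral_smoothingRadius_le hh h_nonneg hl ht]

end SmoothingRadius

section ExtensionByZero

variable {E : Type*} [NormedAddCommGroup E] {T : ℝ}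

theorem exists_stronglyMeasurable_extension {f : ℝ → E} (hf : Integrable f (timeMeasure T)) :
    ∃ g : ℝ → E, StronglyMeasurable g ∧ Integrable g ∧ (∀ t ∉ Ioo 0 T, g t = 0) ∧
      f =ᵐ[timeMeasure T] g := by
  refine ⟨(Ioo 0 T).indicator (hf.1.mk f), hf.1.stronglyMeasurable_mk.indicator measurableSet_Ioo,
    (integrable_indicator_iff measurableSet_Ioo).2 (hf.congr hf.1.ae_eq_mk),
    fun t ht => indicator_of_notMem ht _, ?_⟩
  filter_upwards [hf.1.ae_eq_mk, ae_timeMeasure_mem T] with t h_eq ht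
  rw [indicator_of_mem ht, h_eq]

theorem setIntegral_Iic_eq_intervalIntegral [NormedSpace ℝ E] {f : ℝ → E} (hf : Integrable f)
    (hf_zero : ∀ t ≤ 0, f t = 0) (t : ℝ) : ∫ τ in Iic t, f τ = ∫ τ in 0..t, f τ := by
  rw [← intervalIntegral.integral_Iic_sub_Iic hf.integrableOn hf.integrableOn,
    setIntegral_eq_zero_of_forall_eq_zero (t := Iic 0) hf_zero, sub_zero]

theorem setLIntegral_superlevel_eq {f g : ℝ → ℝ} (hfg : f =ᵐ[timeMeasure T] g)
    (hg : ∀ t ∉ Ioo 0 T, g t = 0) {a : ℝ} (ha : 0 ≤ a) :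
    ∫⁻ t in {t | a < g t}, ENNReal.ofReal (g t) =
      ∫⁻ t in {t | a < f t}, ENNReal.ofReal (f t) ∂(timeMeasure T) := by
  have superlevel_subset : {t | a < g t} ⊆ Ioo 0 T := fun t ht => by
    by_contra h_notMem
    have : a < g t := ht
    exact (this.trans_le ((hg t h_notMem).trans_le ha)).false
  have superlevel_ae_eq : {t | a < f t} =ᵐ[timeMeasure T] {t | a < g t} :=
    hfg.fun_comp (a < ·)
  have ofReal_ae_eq : ∀ᵐ t ∂(timeMeasure T), ENNReal.ofReal (f t) = ENNReal.ofReal (g t) :=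
    hfg.fun_comp ENNReal.ofReal
  rw [setLIntegral_congr superlevel_ae_eq, lintegral_congr_ae (ae_restrict_of_ae ofReal_ae_eq),
    timeMeasure, Measure.restrict_restrict_of_subset superlevel_subset]

end ExtensionByZero

section Truncation

variable {D X : Type*} [NormedAddCommGroup D] [NormedSpace ℂ D] [NormedAddCommGroup X]
  [NormedSpace ℂ X] {ι : D →L[ℂ] X} {T : ℝ} {u : ℝ → D} {w : ℝ → X}

theorem quasiMeasurePreserving_sub_mul (t : ℝ) {δ : ℝ} (hδ : δ ≠ 0) :
    Measure.QuasiMeasurePreserving (fun σ : ℝ => t - σ * δ) := by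
  refine (Measure.measurePreserving_sub_left volume t).quasiMeasurePreserving.comp
    (f := fun σ => σ * δ) ⟨measurable_mul_const δ, ?_⟩
  rw [Real.map_volume_mul_right hδ]
  exact Measure.smul_absolutelyContinuous

theorem IsPrimitivePair.ae_eq_setIntegral_Iic (h : IsPrimitivePair ι T u w) (hw : Integrable w)
    (hu_zero : ∀ t ∉ Ioo 0 T, u t = 0) (hw_zero : ∀ t ∉ Ioo 0 T, w t = 0) :
    ∀ᵐ t : ℝ, t < T → ι (u t) = ∫ τ in Iic t, w τ := by
  have h : ∀ᵐ t : ℝ, t ∈ Ioo 0 T → ι (u t) = ∫ τ in 0..t, w τ :=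
    (ae_restrict_iff' measurableSet_Ioo).1 h
  have notMem_of_nonpos {t : ℝ} (ht : t ≤ 0) : t ∉ Ioo 0 T := fun h_mem => ht.not_gt h_mem.1
  filter_upwards [h] with t h_eq htT
  rcases le_or_gt t 0 with ht | ht
  · rw [hu_zero t (notMem_of_nonpos ht), map_zero,
      setIntegral_eq_zero_of_forall_eq_zero (t := Iic t) fun τ hτ =>
        hw_zero τ (notMem_of_nonpos (le_trans (mem_Iic.1 hτ) ht))]
  · rw [h_eq ⟨ht, htT⟩, setIntegral_Iic_eq_intervalIntegral hw
      fun τ hτ => hw_zero τ (notMem_of_nonpos hτ)]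

theorem ae_map_smoothing_eq [CompleteSpace D] [CompleteSpace X] {ρ : ℝ → ℝ}
    (hρ : LipschitzWith (1 / 2) ρ) (hρ_nonneg : 0 ≤ ρ) (hu : Integrable u)
    (hwm : StronglyMeasurable w) (hw : Integrable w)
    (h : ∀ᵐ t : ℝ, t < T → ι (u t) = ∫ τ in Iic t, w τ) :
    ∀ᵐ t : ℝ, t < T → ι (smoothing ρ u t) = ∫ τ in Iic t, smoothingDeriv ρ w τ := by
  filter_upwards [h] with t h_eq htT
  rw [setIntegral_Iic_smoothingDeriv hρ hwm hw]
  rcases eq_or_ne (ρ t) 0 with hρt | hρt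
  · rw [smoothing_of_eq_zero _ hρt, smoothing_of_eq_zero _ hρt, h_eq htT]
  · rw [smoothing, smoothing,
      ← ContinuousLinearMap.integral_comp_comm ι (integrable_comp_sub_mul hu t hρt).integrableOn]
    refine integral_congr_ae ?_
    filter_upwards [ae_restrict_of_ae ((quasiMeasurePreserving_sub_mul t hρt).ae h),
      ae_restrict_mem measurableSet_Ioo] with σ hσ_eq hσ
    exact hσ_eq ((sub_le_self t (mul_nonneg hσ.1.le (hρ_nonneg t))).trans_lt htT)

theorem isPrimitivePair_smoothing [CompleteSpace D] [CompleteSpace X]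
    (h : IsPrimitivePair ι T u w) {ρ : ℝ → ℝ} (hρ : LipschitzWith (1 / 2) ρ) (hρ_nonneg : 0 ≤ ρ)
    (hu : Integrable u) (hwm : StronglyMeasurable w) (hw : Integrable w)
    (hu_zero : ∀ t ∉ Ioo 0 T, u t = 0) (hw_zero : ∀ t ∉ Ioo 0 T, w t = 0) :
    IsPrimitivePair ι T (smoothing ρ u) (smoothingDeriv ρ w) := by
  have smoothingDeriv_zero : ∀ t ≤ 0, smoothingDeriv ρ w t = 0 := fun t ht =>
    setIntegral_eq_zero_of_forall_eq_zero fun σ hσ => by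
      have : t - σ * ρ t ≤ 0 := by linarith [mul_nonneg hσ.1.le (hρ_nonneg t)]
      rw [hw_zero _ fun h_mem => this.not_gt h_mem.1, smul_zero]
  filter_upwards [ae_restrict_of_ae (ae_map_smoothing_eq hρ hρ_nonneg hu hwm hw
    (h.ae_eq_setIntegral_Iic hw hu_zero hw_zero)), ae_timeMeasure_mem T] with t h_eq ht
  rw [h_eq ht.2, setIntegral_Iic_eq_intervalIntegral (integrable_smoothingDeriv hρ hwm hw)
    smoothingDeriv_zero]

/-- `(v, z)` is a truncation of the pair `(u, w) = (u, u')` at height `l`: it is again a primitive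
pair, it agrees with `(u, w)` off the set `O`, and it is bounded by a multiple of `l` on `O`, whose
measure is controlled by the part of `(u, w)` above height `l / 2`. -/
structure IsTruncation (ι : D →L[ℂ] X) (T l : ℝ) (u : ℝ → D) (w : ℝ → X) (O : Set ℝ) (v : ℝ → D)
    (z : ℝ → X) : Prop where
  measurableSet : MeasurableSet O
  aestronglyMeasurable_fst : AEStronglyMeasurable v (timeMeasure T)
  aestronglyMeasurable_snd : AEStronglyMeasurable z (timeMeasure T)
  isPrimitivePair : IsPrimitivePair ι T v z
  ae_eq_off : ∀ᵐ t ∂(timeMeasure T), t ∉ O → v t = u t ∧ z t = w t ∧ ‖u t‖ + ‖w t‖ ≤ l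
  ae_le_on : ∀ᵐ t ∂(timeMeasure T), t ∈ O → ‖v t‖ ≤ 8 * l ∧ ‖z t‖ ≤ 12 * l
  measure_le : timeMeasure T O ≤ ENNReal.ofReal (10 / l) *
    ∫⁻ t in {t | l / 2 < ‖u t‖ + ‖w t‖}, ENNReal.ofReal (‖u t‖ + ‖w t‖) ∂(timeMeasure T)

theorem isTruncation_smoothing [CompleteSpace D] [CompleteSpace X] {u₀ : ℝ → D} {w₀ : ℝ → X}
    (h : IsPrimitivePair ι T u w) {l : ℝ} (hl : 0 < l) (hu_eq : u =ᵐ[timeMeasure T] u₀)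
    (hw_eq : w =ᵐ[timeMeasure T] w₀) (hum : StronglyMeasurable u₀) (hwm : StronglyMeasurable w₀)
    (hu : Integrable u₀) (hw : Integrable w₀) (hu_zero : ∀ t ∉ Ioo 0 T, u₀ t = 0)
    (hw_zero : ∀ t ∉ Ioo 0 T, w₀ t = 0) :
    IsTruncation ι T l u w (maximalSet (fun t => ‖u₀ t‖ + ‖w₀ t‖) l)
      (smoothing (smoothingRadius (fun t => ‖u₀ t‖ + ‖w₀ t‖) l) u₀)
      (smoothingDeriv (smoothingRadius (fun t => ‖u₀ t‖ + ‖w₀ t‖) l) w₀) := by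
  have hg : Integrable fun t => ‖u₀ t‖ + ‖w₀ t‖ := hu.norm.add hw.norm
  have hg_nonneg : 0 ≤ fun t => ‖u₀ t‖ + ‖w₀ t‖ := fun t => by positivity
  have hg_eq : (fun t => ‖u t‖ + ‖w t‖) =ᵐ[timeMeasure T] fun t => ‖u₀ t‖ + ‖w₀ t‖ := by
    filter_upwards [hu_eq, hw_eq] with t hut hwt
    rw [hut, hwt]
  have hρ := lipschitzWith_smoothingRadius (fun t => ‖u₀ t‖ + ‖w₀ t‖) l
  have hρ_nonneg := smoothingRadius_nonneg (fun t => ‖u₀ t‖ + ‖w₀ t‖) l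
  refine ⟨(isOpen_maximalSet _ l).measurableSet,
    (stronglyMeasurable_smoothing hρ hum).aestronglyMeasurable,
    (stronglyMeasurable_smoothingDeriv hρ hwm).aestronglyMeasurable,
    isPrimitivePair_smoothing (h.congr hu_eq hw_eq) hρ hρ_nonneg hu hwm hw hu_zero hw_zero,
    ?_, Eventually.of_forall fun t ht => ⟨?_, ?_⟩, ?_⟩
  · filter_upwards [ae_restrict_of_ae (ae_le_of_notMem_maximalSet hg l), hu_eq, hw_eq]
      with t h_le hut hwt ht
    have hρt := smoothingRadius_eq_zero ht
    rw [smoothing_of_eq_zero _ hρt, smoothingDeriv_of_eq_zero hρ_nonneg _ hρt, hut, hwt]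
    exact ⟨rfl, rfl, h_le ht⟩
  · exact norm_smoothing_le hg (fun _ => le_add_of_nonneg_right (norm_nonneg _)) hl ht
  · exact norm_smoothingDeriv_le hg (fun _ => le_add_of_nonneg_left (norm_nonneg _)) hl ht
  · have hg_zero : ∀ t ∉ Ioo 0 T, ‖u₀ t‖ + ‖w₀ t‖ = 0 := fun t ht => by
      rw [hu_zero t ht, hw_zero t ht, norm_zero, norm_zero, add_zero]
    rw [← setLIntegral_superlevel_eq hg_eq hg_zero (by positivity)]
    exact (Measure.restrict_le_self _).trans (volume_maximalSet_le hg hg_nonneg hl)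

theorem exists_isTruncation [CompleteSpace D] [CompleteSpace X] (h : IsPrimitivePair ι T u w)
    (hu : Integrable u (timeMeasure T)) (hw : Integrable w (timeMeasure T)) {l : ℝ} (hl : 0 < l) :
    ∃ O v z, IsTruncation ι T l u w O v z := by
  obtain ⟨u₀, hum, hui, hu_zero, hu_eq⟩ := exists_stronglyMeasurable_extension hu
  obtain ⟨w₀, hwm, hwi, hw_zero, hw_eq⟩ := exists_stronglyMeasurable_extension hw
  exact ⟨_, _, _, isTruncation_smoothing h hl hu_eq hw_eq hum hwm hui hwi hu_zero hw_zero⟩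

end Truncation

section LevelSets

variable {α : Type*} {mα : MeasurableSpace α} {μ : Measure α}

theorem ofReal_rpow_mul_ofReal_rpow {x a b : ℝ} (hx : 0 ≤ x) (hab : a + b ≠ 0) :
    ENNReal.ofReal (x ^ a) * ENNReal.ofReal (x ^ b) = ENNReal.ofReal (x ^ (a + b)) := by
  rw [← ENNReal.ofReal_mul (Real.rpow_nonneg hx _), ← Real.rpow_add' hx hab]

theorem ofReal_one_div_mul_ofReal_mul {x : ℝ} (hx : 0 < x) (b : ℝ≥0∞) :
    ENNReal.ofReal (1 / x) * (ENNReal.ofReal x * b) = b := by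
  rw [← mul_assoc, ← ENNReal.ofReal_mul (by positivity), one_div_mul_cancel hx.ne',
    ENNReal.ofReal_one, one_mul]

theorem le_two_mul_of_le_add_ofReal_mul {a b : ℝ≥0∞} {c : ℝ} (hc : c ≤ 1 / 2) (ha : a ≠ ⊤)
    (h : a ≤ b + ENNReal.ofReal c * a) : a ≤ 2 * b := by
  have hc' : ENNReal.ofReal c ≤ 2⁻¹ := by
    rw [← ENNReal.ofReal_ofNat 2, ← ENNReal.ofReal_inv_of_pos two_pos]
    exact ENNReal.ofReal_le_ofReal (hc.trans (one_div 2).le)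
  have half_add_half_le : 2⁻¹ * a + 2⁻¹ * a ≤ b + 2⁻¹ * a := by
    rw [← add_mul, ENNReal.inv_two_add_inv_two, one_mul]
    exact h.trans (by gcongr)
  calc a = 2 * (2⁻¹ * a) := by
        rw [← mul_assoc, ENNReal.mul_inv_cancel (by simp) (by simp), one_mul]
    _ ≤ 2 * b := by
        gcongr
        exact (ENNReal.add_le_add_iff_right (ENNReal.mul_ne_top (by simp) ha)).1 half_add_half_le

theorem lintegral_mul_rpow_eq_lintegral_superlevel {g f : α → ℝ} (hg : AEMeasurable g μ)
    (hf : AEMeasurable f μ) (hf_nonneg : 0 ≤ f) {q : ℝ} (hq : 0 < q) :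
    ∫⁻ a, ENNReal.ofReal (g a) * ENNReal.ofReal (f a ^ q) ∂μ =
      ENNReal.ofReal q * ∫⁻ l in Ioi (0 : ℝ),
        (∫⁻ a in {a | l < f a}, ENNReal.ofReal (g a) ∂μ) * ENNReal.ofReal (l ^ (q - 1)) := by
  have layer_cake := lintegral_rpow_eq_lintegral_meas_lt_mul
    (μ.withDensity fun a => ENNReal.ofReal (g a)) (Eventually.of_forall hf_nonneg)
    (hf.mono_ac (withDensity_absolutelyContinuous _ _)) hq
  rw [lintegral_withDensity_eq_lintegral_mul₀ hg.ennreal_ofReal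
    (hf.pow_const q).ennreal_ofReal] at layer_cake
  simp only [Pi.mul_apply] at layer_cake
  simp_rw [layer_cake, withDensity_apply₀ _ (nullMeasurableSet_lt aemeasurable_const hf)]

theorem lintegral_rpow_eq_lintegral_superlevel {f : α → ℝ} (hf : AEMeasurable f μ)
    (hf_nonneg : 0 ≤ f) {r s : ℝ} (hs : s ≠ 0) (hrs : r < s) :
    ∫⁻ a, ENNReal.ofReal (f a ^ s) ∂μ = ENNReal.ofReal (s - r) * ∫⁻ l in Ioi (0 : ℝ),
      (∫⁻ a in {a | l < f a}, ENNReal.ofReal (f a ^ r) ∂μ) * ENNReal.ofReal (l ^ (s - r - 1)) := by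
  rw [← lintegral_mul_rpow_eq_lintegral_superlevel (hf.pow_const r) hf hf_nonneg (sub_pos.2 hrs)]
  refine lintegral_congr fun a => ?_
  rw [ofReal_rpow_mul_ofReal_rpow (hf_nonneg a) (by simpa using hs), add_sub_cancel]

/-- The hypothesis of Gehring's lemma in level set form: the part of `h ^ r` above height `l` is
controlled by that of `k ^ r` and by the part of `h` above height `l / 2`. -/
def SuperlevelInequality (μ : Measure α) (r : ℝ) (C : ℝ≥0) (h k : α → ℝ) : Prop :=
  ∀ l : ℝ, 0 < l → ∫⁻ a in {a | l < h a}, ENNReal.ofReal (h a ^ r) ∂μ ≤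
    C * ((∫⁻ a in {a | l < k a}, ENNReal.ofReal (k a ^ r) ∂μ) +
      ENNReal.ofReal (l ^ (r - 1)) * ∫⁻ a in {a | l / 2 < h a}, ENNReal.ofReal (h a) ∂μ)

/-- The counterpart of `SuperlevelInequality` for the parts of `h ^ r` and `k ^ r` below height `l`;
the first two terms on the right together are the integral of `min k l ^ r`. -/
def SublevelInequality (μ : Measure α) (r : ℝ) (C : ℝ≥0) (h k : α → ℝ) : Prop :=
  ∀ l : ℝ, 0 < l → ∫⁻ a in {a | h a ≤ l}, ENNReal.ofReal (h a ^ r) ∂μ ≤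
    C * ((∫⁻ a in {a | k a ≤ l}, ENNReal.ofReal (k a ^ r) ∂μ) +
      ENNReal.ofReal (l ^ r) * μ {a | l < k a} +
      ENNReal.ofReal (l ^ (r - 1)) * ∫⁻ a in {a | l / 2 < h a}, ENNReal.ofReal (h a) ∂μ)

variable {h k : α → ℝ} {r s L : ℝ} {C : ℝ≥0}

theorem mul_min_two_mul_rpow_le {x : ℝ} (hx : 0 ≤ x) (hL : 0 < L) (hr : 1 < r) (hrs : r < s) :
    x * min (2 * x) L ^ (s - 1) ≤ 2 ^ (s - 1) * (x ^ r * min x L ^ (s - r)) := by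
  rcases hx.eq_or_lt with rfl | hx
  · rw [zero_mul]
    positivity
  have hm : 0 < min x L := lt_min hx hL
  calc x * min (2 * x) L ^ (s - 1) ≤ x * (2 * min x L) ^ (s - 1) := by
        gcongr
        · exact sub_nonneg.2 (hr.trans hrs).le
        · rw [mul_min_of_nonneg _ _ two_pos.le]
          exact min_le_min le_rfl (by linarith)
    _ = 2 ^ (s - 1) * (x * min x L ^ (r - 1) * min x L ^ (s - r)) := by
        rw [Real.mul_rpow two_pos.le hm.le, mul_assoc x, ← Real.rpow_add hm,
          show r - 1 + (s - r) = s - 1 by ring]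
        ring
    _ ≤ 2 ^ (s - 1) * (x * x ^ (r - 1) * min x L ^ (s - r)) := by
        gcongr
        exact min_le_left _ _
    _ = 2 ^ (s - 1) * (x ^ r * min x L ^ (s - r)) := by
        rw [← Real.rpow_one_add' hx.le (by linarith), add_sub_cancel]

theorem lintegral_mul_min_rpow_ne_top (h_nonneg : 0 ≤ h) (hrs : r < s) (hL : 0 < L)
    (hfin : ∫⁻ a, ENNReal.ofReal (h a ^ r) ∂μ ≠ ⊤) :
    ∫⁻ a, ENNReal.ofReal (h a ^ r) * ENNReal.ofReal (min (h a) L ^ (s - r)) ∂μ ≠ ⊤ := by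
  refine ne_top_of_le_ne_top (ENNReal.mul_ne_top hfin ENNReal.ofReal_ne_top)
    (b := _ * ENNReal.ofReal (L ^ (s - r))) ?_
  rw [← lintegral_mul_const' _ _ ENNReal.ofReal_ne_top]
  refine lintegral_mono fun a => ?_
  gcongr
  · exact le_min (h_nonneg a) hL.le
  · exact min_le_right _ _

theorem lintegral_superlevel_min_two_mul_le (hm : AEMeasurable h μ) (h_nonneg : 0 ≤ h)
    (hr : 1 < r) (hrs : r < s) (hL : 0 < L) :
    ∫⁻ l in Ioi (0 : ℝ), (∫⁻ a in {a | l < min (2 * h a) L}, ENNReal.ofReal (h a) ∂μ) *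
        ENNReal.ofReal (l ^ (s - 1 - 1)) ≤
      ENNReal.ofReal (2 ^ (s - 1) / (s - 1)) *
        ∫⁻ a, ENNReal.ofReal (h a ^ r) * ENNReal.ofReal (min (h a) L ^ (s - r)) ∂μ := by
  have hs : 0 < s - 1 := by linarith
  rw [← ofReal_one_div_mul_ofReal_mul hs (lintegral _ _),
    ← lintegral_mul_rpow_eq_lintegral_superlevel hm ((hm.const_mul 2).min aemeasurable_const)
      (fun a => le_min (mul_nonneg two_pos.le (h_nonneg a)) hL.le) hs,
    div_eq_mul_one_div (2 ^ (s - 1)), mul_comm (2 ^ (s - 1)), ENNReal.ofReal_mul (by positivity),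
    mul_assoc, ← lintegral_const_mul' (ENNReal.ofReal (2 ^ (s - 1))) _ ENNReal.ofReal_ne_top]
  gcongr _ * ?_
  refine lintegral_mono fun a => ?_
  rw [← ENNReal.ofReal_mul (h_nonneg a), ← ENNReal.ofReal_mul (Real.rpow_nonneg (h_nonneg a) _),
    ← ENNReal.ofReal_mul (by positivity)]
  exact ENNReal.ofReal_le_ofReal (mul_min_two_mul_rpow_le (h_nonneg a) hL hr hrs)

theorem SuperlevelInequality.min_mul_le (H : SuperlevelInequality μ r C h k) {l : ℝ} (hl : 0 < l) :
    (∫⁻ a in {a | l < min (h a) L}, ENNReal.ofReal (h a ^ r) ∂μ) *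
        ENNReal.ofReal (l ^ (s - r - 1)) ≤
      C * ((∫⁻ a in {a | l < k a}, ENNReal.ofReal (k a ^ r) ∂μ) *
          ENNReal.ofReal (l ^ (s - r - 1)) +
        (∫⁻ a in {a | l < min (2 * h a) L}, ENNReal.ofReal (h a) ∂μ) *
          ENNReal.ofReal (l ^ (s - 1 - 1))) := by
  rcases le_or_gt L l with hLl | hLl
  · have h_empty : {a | l < min (h a) L} = ∅ :=
      eq_empty_of_forall_notMem fun a ha => (lt_min_iff.1 ha).2.not_ge hLl
    rw [h_empty, Measure.restrict_empty, lintegral_zero_measure, zero_mul]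
    exact zero_le
  have superlevel_min : {a | l < min (h a) L} = {a | l < h a} := by
    simp only [lt_min_iff, hLl, and_true]
  have superlevel_min_two_mul : {a | l < min (2 * h a) L} = {a | l / 2 < h a} := by
    simp only [lt_min_iff, hLl, and_true, div_lt_iff₀' (two_pos (α := ℝ))]
  have rpow_split : ENNReal.ofReal (l ^ (s - 1 - 1)) =
      ENNReal.ofReal (l ^ (r - 1)) * ENNReal.ofReal (l ^ (s - r - 1)) := by
    rw [← ENNReal.ofReal_mul (by positivity), ← Real.rpow_add hl]
    ring_nf
  rw [superlevel_min, superlevel_min_two_mul, rpow_split]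
  exact (mul_le_mul_left (H l hl) _).trans_eq (by ring)

theorem SuperlevelInequality.lintegral_mul_min_rpow_le (H : SuperlevelInequality μ r C h k)
    (hm : AEMeasurable h μ) (km : AEMeasurable k μ) (h_nonneg : 0 ≤ h) (k_nonneg : 0 ≤ k)
    (hr : 1 < r) (hrs : r < s) (hfin : ∫⁻ a, ENNReal.ofReal (h a ^ r) ∂μ ≠ ⊤)
    (hsmall : C * (s - r) * (2 ^ (s - 1) / (s - 1)) ≤ 1 / 2) (hL : 0 < L) :
    ∫⁻ a, ENNReal.ofReal (h a ^ r) * ENNReal.ofReal (min (h a) L ^ (s - r)) ∂μ ≤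
      2 * (C * ∫⁻ a, ENNReal.ofReal (k a ^ s) ∂μ) := by
  have hsr : 0 < s - r := sub_pos.2 hrs
  refine le_two_mul_of_le_add_ofReal_mul hsmall
    (lintegral_mul_min_rpow_ne_top h_nonneg hrs hL hfin) ?_
  have measurable_tail : Measurable fun l : ℝ =>
      (∫⁻ a in {a | l < k a}, ENNReal.ofReal (k a ^ r) ∂μ) * ENNReal.ofReal (l ^ (s - r - 1)) :=
    (Antitone.measurable fun _ _ hll' =>
      lintegral_mono_set fun _ => hll'.trans_lt).mul (by fun_prop)
  calc ∫⁻ a, ENNReal.ofReal (h a ^ r) * ENNReal.ofReal (min (h a) L ^ (s - r)) ∂μ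
    _ = ENNReal.ofReal (s - r) * ∫⁻ l in Ioi (0 : ℝ),
        (∫⁻ a in {a | l < min (h a) L}, ENNReal.ofReal (h a ^ r) ∂μ) *
          ENNReal.ofReal (l ^ (s - r - 1)) :=
      lintegral_mul_rpow_eq_lintegral_superlevel (hm.pow_const r) (hm.min aemeasurable_const)
        (fun a => le_min (h_nonneg a) hL.le) hsr
    _ ≤ ENNReal.ofReal (s - r) * ∫⁻ l in Ioi (0 : ℝ), (C : ℝ≥0∞) *
        ((∫⁻ a in {a | l < k a}, ENNReal.ofReal (k a ^ r) ∂μ) * ENNReal.ofReal (l ^ (s - r - 1)) +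
          (∫⁻ a in {a | l < min (2 * h a) L}, ENNReal.ofReal (h a) ∂μ) *
            ENNReal.ofReal (l ^ (s - 1 - 1))) := by
      gcongr ENNReal.ofReal (s - r) * ?_
      exact setLIntegral_mono' measurableSet_Ioi fun l hl => H.min_mul_le hl
    _ = C * (∫⁻ a, ENNReal.ofReal (k a ^ s) ∂μ) +
        C * ENNReal.ofReal (s - r) * ∫⁻ l in Ioi (0 : ℝ),
          (∫⁻ a in {a | l < min (2 * h a) L}, ENNReal.ofReal (h a) ∂μ) *
            ENNReal.ofReal (l ^ (s - 1 - 1)) := by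
      rw [lintegral_const_mul' _ _ ENNReal.coe_ne_top, lintegral_add_left measurable_tail,
        lintegral_rpow_eq_lintegral_superlevel km k_nonneg (by linarith) hrs]
      ring
    _ ≤ _ := by
      rw [ENNReal.ofReal_mul (by positivity), ENNReal.ofReal_mul C.coe_nonneg,
        ENNReal.ofReal_coe_nnreal, mul_assoc (_ * _)]
      gcongr
      exact lintegral_superlevel_min_two_mul_le hm h_nonneg hr hrs hL

theorem tendsto_lintegral_mul_min_rpow (hm : AEMeasurable h μ) (h_nonneg : 0 ≤ h) (hr : 0 < r)
    (hrs : r < s) :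
    Tendsto (fun n : ℕ => ∫⁻ a, ENNReal.ofReal (h a ^ r) *
      ENNReal.ofReal (min (h a) ((n : ℝ) + 1) ^ (s - r)) ∂μ) atTop
      (𝓝 (∫⁻ a, ENNReal.ofReal (h a ^ s) ∂μ)) := by
  refine lintegral_tendsto_of_tendsto_of_monotone (fun n => ?_)
    (Eventually.of_forall fun a n m hnm => ?_) (Eventually.of_forall fun a => ?_)
  · exact ((hm.pow_const r).ennreal_ofReal.mul
      ((hm.min aemeasurable_const).pow_const _).ennreal_ofReal)
  · have hnm : (n : ℝ) ≤ m := Nat.cast_le.2 hnm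
    dsimp only
    gcongr
    exact le_min (h_nonneg a) (by positivity)
  · refine tendsto_const_nhds.congr' ?_
    obtain ⟨N, hN⟩ := exists_nat_ge (h a)
    filter_upwards [eventually_ge_atTop N] with n hn
    have hn : (N : ℝ) ≤ n := Nat.cast_le.2 hn
    rw [min_eq_left (by linarith), ofReal_rpow_mul_ofReal_rpow (h_nonneg a) (by linarith),
      add_sub_cancel]

theorem SuperlevelInequality.lintegral_rpow_le (H : SuperlevelInequality μ r C h k)
    (hm : AEMeasurable h μ) (km : AEMeasurable k μ) (h_nonneg : 0 ≤ h) (k_nonneg : 0 ≤ k)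
    (hr : 1 < r) (hrs : r < s) (hfin : ∫⁻ a, ENNReal.ofReal (h a ^ r) ∂μ ≠ ⊤)
    (hsmall : C * (s - r) * (2 ^ (s - 1) / (s - 1)) ≤ 1 / 2) :
    ∫⁻ a, ENNReal.ofReal (h a ^ s) ∂μ ≤
      2 * (C * ∫⁻ a, ENNReal.ofReal (k a ^ s) ∂μ) :=
  le_of_tendsto' (tendsto_lintegral_mul_min_rpow hm h_nonneg (by linarith) hrs) fun _ =>
    H.lintegral_mul_min_rpow_le hm km h_nonneg k_nonneg hr hrs hfin hsmall (by positivity)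

theorem lintegral_Ioi_indicator_Ici_rpow {x q : ℝ} (hx : 0 < x) (hq : 0 < q) :
    ∫⁻ l in Ioi (0 : ℝ), (Ici x).indicator (fun l => ENNReal.ofReal (l ^ (-q - 1))) l =
      ENNReal.ofReal (1 / q) * ENNReal.ofReal (x ^ (-q)) := by
  have hsub : Ici x ∩ Ioi 0 = Ici x := inter_eq_left.2 fun l hl => hx.trans_le hl
  rw [setLIntegral_indicator measurableSet_Ici, hsub, ← restrict_Ioi_eq_restrict_Ici,
    ← ofReal_integral_eq_lintegral_ofReal, integral_Ioi_rpow_of_lt (by linarith) hx,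
    ← ENNReal.ofReal_mul (by positivity), sub_add_cancel, neg_div_neg_eq, one_div_mul_eq_div]
  · exact integrableOn_Ioi_rpow_of_lt (by linarith) hx
  · filter_upwards [ae_restrict_mem measurableSet_Ioi] with l hl
    exact Real.rpow_nonneg (hx.trans hl).le _

theorem rpow_mul_lintegral_Ioi_indicator_Ici {x : ℝ} (hx : 0 ≤ x) (hs : 0 < s) (hsr : s < r) :
    ENNReal.ofReal (x ^ r) * ∫⁻ l in Ioi (0 : ℝ),
        (Ici x).indicator (fun l => ENNReal.ofReal (l ^ (s - r - 1))) l =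
      ENNReal.ofReal (1 / (r - s)) * ENNReal.ofReal (x ^ s) := by
  rcases hx.eq_or_lt with rfl | hx
  · rw [Real.zero_rpow (by linarith), Real.zero_rpow hs.ne', ENNReal.ofReal_zero, zero_mul,
      mul_zero]
  · rw [← neg_sub r s, lintegral_Ioi_indicator_Ici_rpow hx (sub_pos.2 hsr), mul_left_comm,
      ofReal_rpow_mul_ofReal_rpow hx.le (by linarith)]
    ring_nf

theorem aemeasurable_uncurry_indicator_Ici {f : α → ℝ} (hf : AEMeasurable f μ)
    {ν : Measure ℝ} {φ : ℝ → ℝ≥0∞} (hφ : Measurable φ) :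
    AEMeasurable (fun p : ℝ × α => (Ici (f p.2)).indicator φ p.1) (ν.prod μ) := by
  have h_eq : (fun p : ℝ × α => (Ici (f p.2)).indicator φ p.1) =
      {p : ℝ × α | f p.2 ≤ p.1}.indicator fun p => φ p.1 := by
    ext p
    simp only [indicator, mem_Ici, mem_ofPred_eq]
  rw [h_eq]
  exact (hφ.comp measurable_fst).aemeasurable.indicator₀
    (nullMeasurableSet_le hf.comp_snd measurable_fst.aemeasurable)

theorem lintegral_sublevel_mul_rpow_eq [SFinite μ] {f : α → ℝ} (hf : AEMeasurable f μ)
    (hf_nonneg : 0 ≤ f) (hs : 0 < s) (hsr : s < r) :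
    ∫⁻ l in Ioi (0 : ℝ), (∫⁻ a in {a | f a ≤ l}, ENNReal.ofReal (f a ^ r) ∂μ) *
        ENNReal.ofReal (l ^ (s - r - 1)) =
      ENNReal.ofReal (1 / (r - s)) * ∫⁻ a, ENNReal.ofReal (f a ^ s) ∂μ := by
  have sublevel_eq : ∀ l : ℝ, (∫⁻ a in {a | f a ≤ l}, ENNReal.ofReal (f a ^ r) ∂μ) *
      ENNReal.ofReal (l ^ (s - r - 1)) = ∫⁻ a, ENNReal.ofReal (f a ^ r) *
        (Ici (f a)).indicator (fun l => ENNReal.ofReal (l ^ (s - r - 1))) l ∂μ := by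
    intro l
    rw [← lintegral_mul_const' _ _ ENNReal.ofReal_ne_top,
      ← lintegral_indicator₀ (nullMeasurableSet_le hf aemeasurable_const)]
    refine lintegral_congr fun a => ?_
    simp only [indicator, mem_Ici, mem_ofPred_eq, mul_ite, mul_zero]
  simp_rw [sublevel_eq]
  rw [lintegral_lintegral_swap, ← lintegral_const_mul' _ _ ENNReal.ofReal_ne_top]
  · refine lintegral_congr fun a => ?_
    rw [lintegral_const_mul' _ _ ENNReal.ofReal_ne_top,
      rpow_mul_lintegral_Ioi_indicator_Ici (hf_nonneg a) hs hsr]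
  · exact (hf.comp_snd.pow_const r).ennreal_ofReal.mul
      (aemeasurable_uncurry_indicator_Ici hf (by fun_prop))

theorem lintegral_superlevel_half_eq (hm : AEMeasurable h μ) (h_nonneg : 0 ≤ h) (hs : 1 < s) :
    ∫⁻ l in Ioi (0 : ℝ), (∫⁻ a in {a | l / 2 < h a}, ENNReal.ofReal (h a) ∂μ) *
        ENNReal.ofReal (l ^ (s - 1 - 1)) =
      ENNReal.ofReal (2 ^ (s - 1) / (s - 1)) * ∫⁻ a, ENNReal.ofReal (h a ^ s) ∂μ := by
  have hs' : 0 < s - 1 := sub_pos.2 hs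
  simp_rw [div_lt_iff₀' (two_pos (α := ℝ))]
  rw [← ofReal_one_div_mul_ofReal_mul hs' (lintegral _ _),
    ← lintegral_mul_rpow_eq_lintegral_superlevel hm (hm.const_mul 2)
      (fun a => mul_nonneg two_pos.le (h_nonneg a)) hs',
    div_eq_mul_one_div (2 ^ (s - 1)), mul_comm (2 ^ (s - 1)), ENNReal.ofReal_mul (by positivity),
    mul_assoc, ← lintegral_const_mul' (ENNReal.ofReal (2 ^ (s - 1))) _ ENNReal.ofReal_ne_top]
  congr 1
  refine lintegral_congr fun a => ?_
  rw [← ENNReal.ofReal_mul (h_nonneg a), ← ENNReal.ofReal_mul (by positivity),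
    Real.mul_rpow two_pos.le (h_nonneg a), mul_left_comm,
    ← Real.rpow_one_add' (h_nonneg a) (by linarith), add_sub_cancel]

theorem SublevelInequality.mul_rpow_le (H : SublevelInequality μ r C h k) {l : ℝ} (hl : 0 < l) :
    (∫⁻ a in {a | h a ≤ l}, ENNReal.ofReal (h a ^ r) ∂μ) * ENNReal.ofReal (l ^ (s - r - 1)) ≤
      C *
        ((∫⁻ a in {a | k a ≤ l}, ENNReal.ofReal (k a ^ r) ∂μ) * ENNReal.ofReal (l ^ (s - r - 1)) +
          μ {a | l < k a} * ENNReal.ofReal (l ^ (s - 1)) +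
          (∫⁻ a in {a | l / 2 < h a}, ENNReal.ofReal (h a) ∂μ) *
            ENNReal.ofReal (l ^ (s - 1 - 1))) := by
  have rpow_split (p q : ℝ) (hpq : p = q + (s - r - 1)) : ENNReal.ofReal (l ^ p) =
      ENNReal.ofReal (l ^ q) * ENNReal.ofReal (l ^ (s - r - 1)) := by
    rw [← ENNReal.ofReal_mul (by positivity), ← Real.rpow_add hl, hpq]
  rw [rpow_split (s - 1) r (by ring), rpow_split (s - 1 - 1) (r - 1) (by ring)]
  exact (mul_le_mul_left (H l hl) _).trans_eq (by ring)

theorem SublevelInequality.lintegral_rpow_le_add [SFinite μ] (H : SublevelInequality μ r C h k)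
    (hm : AEMeasurable h μ) (km : AEMeasurable k μ) (h_nonneg : 0 ≤ h) (k_nonneg : 0 ≤ k)
    (hs : 1 < s) (hsr : s < r) :
    ENNReal.ofReal (1 / (r - s)) * ∫⁻ a, ENNReal.ofReal (h a ^ s) ∂μ ≤
      C * (ENNReal.ofReal (1 / (r - s)) * ∫⁻ a, ENNReal.ofReal (k a ^ s) ∂μ +
        ENNReal.ofReal (1 / s) * ∫⁻ a, ENNReal.ofReal (k a ^ s) ∂μ +
        ENNReal.ofReal (2 ^ (s - 1) / (s - 1)) * ∫⁻ a, ENNReal.ofReal (h a ^ s) ∂μ) := by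
  have hs' : 0 < s := by linarith
  have meas_superlevel_eq : ∫⁻ l in Ioi (0 : ℝ), μ {a | l < k a} * ENNReal.ofReal (l ^ (s - 1)) =
      ENNReal.ofReal (1 / s) * ∫⁻ a, ENNReal.ofReal (k a ^ s) ∂μ := by
    rw [lintegral_rpow_eq_lintegral_meas_lt_mul μ (Eventually.of_forall k_nonneg)
      km hs', ofReal_one_div_mul_ofReal_mul hs']
  have measurable_sublevel : Measurable fun l : ℝ =>
      (∫⁻ a in {a | k a ≤ l}, ENNReal.ofReal (k a ^ r) ∂μ) * ENNReal.ofReal (l ^ (s - r - 1)) :=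
    (Monotone.measurable fun l l' hll' =>
      lintegral_mono_set fun a (ha : k a ≤ l) => ha.trans hll').mul (by fun_prop)
  have measurable_superlevel : Measurable fun l : ℝ =>
      μ {a | l < k a} * ENNReal.ofReal (l ^ (s - 1)) :=
    (Antitone.measurable fun l l' hll' =>
      measure_mono fun a (ha : l' < k a) => hll'.trans_lt ha).mul (by fun_prop)
  rw [← lintegral_sublevel_mul_rpow_eq hm h_nonneg hs' hsr,
    ← lintegral_sublevel_mul_rpow_eq km k_nonneg hs' hsr, ← meas_superlevel_eq,
    ← lintegral_superlevel_half_eq hm h_nonneg hs, ← lintegral_add_left measurable_sublevel,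
    ← lintegral_add_left (measurable_sublevel.fun_add measurable_superlevel),
    ← lintegral_const_mul' _ _ ENNReal.coe_ne_top]
  exact setLIntegral_mono' measurableSet_Ioi fun l hl => H.mul_rpow_le hl

theorem SublevelInequality.lintegral_rpow_le [SFinite μ] (H : SublevelInequality μ r C h k)
    (hm : AEMeasurable h μ) (km : AEMeasurable k μ) (h_nonneg : 0 ≤ h) (k_nonneg : 0 ≤ k)
    (hs : 1 < s) (hsr : s < r) (hfin : ∫⁻ a, ENNReal.ofReal (h a ^ s) ∂μ ≠ ⊤)
    (hsmall : C * (r - s) * (2 ^ (s - 1) / (s - 1)) ≤ 1 / 2) :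
    ∫⁻ a, ENNReal.ofReal (h a ^ s) ∂μ ≤
      2 * (C * ENNReal.ofReal r * ∫⁻ a, ENNReal.ofReal (k a ^ s) ∂μ) := by
  have hrs : 0 < r - s := sub_pos.2 hsr
  have bound := H.lintegral_rpow_le_add hm km h_nonneg k_nonneg hs hsr
  refine le_two_mul_of_le_add_ofReal_mul hsmall hfin ?_
  set I := ∫⁻ a, ENNReal.ofReal (h a ^ s) ∂μ
  set K := ∫⁻ a, ENNReal.ofReal (k a ^ s) ∂μ
  have add_le : 1 + ENNReal.ofReal (r - s) * ENNReal.ofReal (1 / s) ≤ ENNReal.ofReal r := by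
    rw [← ENNReal.ofReal_mul hrs.le, ← ENNReal.ofReal_one,
      ← ENNReal.ofReal_add zero_le_one (by positivity)]
    gcongr
    rw [show 1 + (r - s) * (1 / s) = r / s by field_simp; ring]
    exact div_le_self (by linarith) hs.le
  calc I = ENNReal.ofReal (r - s) * (ENNReal.ofReal (1 / (r - s)) * I) := by
        rw [mul_left_comm, ofReal_one_div_mul_ofReal_mul hrs]
    _ ≤ ENNReal.ofReal (r - s) * (C * (ENNReal.ofReal (1 / (r - s)) * K +
          ENNReal.ofReal (1 / s) * K + ENNReal.ofReal (2 ^ (s - 1) / (s - 1)) * I)) := by gcongr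
    _ = C * (ENNReal.ofReal (1 / (r - s)) * (ENNReal.ofReal (r - s) * K) +
          ENNReal.ofReal (r - s) * ENNReal.ofReal (1 / s) * K) +
        C * ENNReal.ofReal (r - s) *
          ENNReal.ofReal (2 ^ (s - 1) / (s - 1)) * I := by ring
    _ ≤ C * ENNReal.ofReal r * K +
        ENNReal.ofReal (C * (r - s) * (2 ^ (s - 1) / (s - 1))) * I := by
        rw [ofReal_one_div_mul_ofReal_mul hrs, ← one_add_mul, mul_assoc _ _ K,
          ENNReal.ofReal_mul (by positivity), ENNReal.ofReal_mul C.coe_nonneg,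
          ENNReal.ofReal_coe_nnreal]
        gcongr

end LevelSets

section RpowIntegrals

variable {α : Type*} {mα : MeasurableSpace α} {μ : Measure α} {E : Type*} [NormedAddCommGroup E]
  {r : ℝ}

theorem lintegral_ofReal_norm_rpow (hr : 0 < r) (f : α → E) :
    ∫⁻ a, ENNReal.ofReal (‖f a‖ ^ r) ∂μ = eLpNorm f (ENNReal.ofReal r) μ ^ r := by
  rw [eLpNorm_eq_lintegral_rpow_enorm_toReal (by simpa using hr) ENNReal.ofReal_ne_top,
    ENNReal.toReal_ofReal hr.le, ← ENNReal.rpow_mul, one_div_mul_cancel hr.ne', ENNReal.rpow_one]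
  refine lintegral_congr fun a => ?_
  rw [← ENNReal.ofReal_rpow_of_nonneg (norm_nonneg _) hr.le, ofReal_norm]

theorem lintegral_ofReal_norm_rpow_ne_top (hr : 0 < r) {f : α → E}
    (hf : MemLp f (ENNReal.ofReal r) μ) : ∫⁻ a, ENNReal.ofReal (‖f a‖ ^ r) ∂μ ≠ ⊤ := by
  rw [lintegral_ofReal_norm_rpow hr]
  exact ENNReal.rpow_ne_top_of_nonneg hr.le hf.2.ne

theorem lintegral_norm_add_norm_rpow_ne_top {F : Type*} [NormedAddCommGroup F] (hr : 0 < r)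
    {f : α → E} {g : α → F} (hf : MemLp f (ENNReal.ofReal r) μ)
    (hg : MemLp g (ENNReal.ofReal r) μ) :
    ∫⁻ a, ENNReal.ofReal ((‖f a‖ + ‖g a‖) ^ r) ∂μ ≠ ⊤ := by
  refine ne_of_eq_of_ne (lintegral_congr fun a => ?_)
    (lintegral_ofReal_norm_rpow_ne_top hr (hf.norm.add hg.norm))
  rw [Pi.add_apply, Real.norm_of_nonneg (by positivity)]

theorem lintegral_ofReal_norm_rpow_of_ae_eq (hr : 0 < r) {F : Lp E (ENNReal.ofReal r) μ}
    {f : α → E} (h : F =ᵐ[μ] f) :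
    ∫⁻ a, ENNReal.ofReal (‖f a‖ ^ r) ∂μ = ENNReal.ofReal (‖F‖ ^ r) := by
  rw [lintegral_ofReal_norm_rpow hr, ← eLpNorm_congr_ae h, Lp.norm_def,
    ← ENNReal.ofReal_rpow_of_nonneg ENNReal.toReal_nonneg hr.le,
    ENNReal.ofReal_toReal (Lp.eLpNorm_ne_top F)]

theorem memLp_of_lintegral_rpow_ne_top (hr : 0 < r) {f : α → E} {g : α → ℝ}
    (hf : AEStronglyMeasurable f μ) (hfg : ∀ a, ‖f a‖ ≤ g a)
    (hg : ∫⁻ a, ENNReal.ofReal (g a ^ r) ∂μ ≠ ⊤) : MemLp f (ENNReal.ofReal r) μ := by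
  have lintegral_ne_top : ∫⁻ a, ENNReal.ofReal (‖f a‖ ^ r) ∂μ ≠ ⊤ :=
    ne_top_of_le_ne_top hg <| lintegral_mono fun a => by gcongr; exact hfg a
  rw [lintegral_ofReal_norm_rpow hr] at lintegral_ne_top
  exact ⟨hf, lt_top_iff_ne_top.2 fun h_top =>
    lintegral_ne_top (by rw [h_top, ENNReal.top_rpow_of_pos hr])⟩

theorem lintegral_add_rpow_le (hr : 0 ≤ r) {f g : α → ℝ} (hf : AEMeasurable f μ)
    (hf_nonneg : 0 ≤ f) (hg_nonneg : 0 ≤ g) :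
    ∫⁻ a, ENNReal.ofReal ((f a + g a) ^ r) ∂μ ≤ 2 ^ r *
      ((∫⁻ a, ENNReal.ofReal (f a ^ r) ∂μ) + ∫⁻ a, ENNReal.ofReal (g a ^ r) ∂μ) := by
  rw [← lintegral_add_left' (hf.pow_const r).ennreal_ofReal,
    ← lintegral_const_mul' _ _ (ENNReal.rpow_ne_top_of_nonneg hr (by simp))]
  refine lintegral_mono fun a => ?_
  rw [← ENNReal.ofReal_rpow_of_nonneg (add_nonneg (hf_nonneg a) (hg_nonneg a)) hr,
    ← ENNReal.ofReal_rpow_of_nonneg (hf_nonneg a) hr,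
    ← ENNReal.ofReal_rpow_of_nonneg (hg_nonneg a) hr,
    ENNReal.ofReal_add (hf_nonneg a) (hg_nonneg a)]
  exact ENNReal.add_rpow_le_two_rpow_mul_rpow_add_rpow _ _ hr

theorem setLIntegral_rpow_le_of_le_add (hr : 0 ≤ r) {f g : α → ℝ} {c : ℝ} {s : Set α}
    (hg : AEMeasurable g μ) (hf_nonneg : 0 ≤ f) (hg_nonneg : 0 ≤ g) (hc : 0 ≤ c)
    (hs : MeasurableSet s) (h : ∀ᵐ a ∂μ, a ∈ s → f a ≤ g a + c) :
    ∫⁻ a in s, ENNReal.ofReal (f a ^ r) ∂μ ≤ 2 ^ r *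
      ((∫⁻ a in s, ENNReal.ofReal (g a ^ r) ∂μ) + ENNReal.ofReal (c ^ r) * μ s) := by
  rw [← setLIntegral_const]
  refine (setLIntegral_mono_ae' hs ?_).trans
    (lintegral_add_rpow_le hr hg.restrict hg_nonneg fun _ => hc)
  filter_upwards [h] with a h_le ha
  exact ENNReal.ofReal_le_ofReal (Real.rpow_le_rpow (hf_nonneg a) (h_le ha) hr)

theorem setLIntegral_rpow_le_const_mul (hr : 0 ≤ r) {f : α → ℝ} {c : ℝ} {s : Set α}
    (hf_nonneg : 0 ≤ f) (h : ∀ᵐ a ∂μ, a ∈ s → f a ≤ c) :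
    ∫⁻ a in s, ENNReal.ofReal (f a ^ r) ∂μ ≤ ENNReal.ofReal (c ^ r) * μ s := by
  rw [← setLIntegral_const]
  refine setLIntegral_mono_ae aemeasurable_const ?_
  filter_upwards [h] with a h_le ha
  exact ENNReal.ofReal_le_ofReal (Real.rpow_le_rpow (hf_nonneg a) (h_le ha) hr)

theorem setLIntegral_rpow_le_superlevel_add (hr : 0 ≤ r) {f : α → ℝ} (hf_nonneg : 0 ≤ f) (l : ℝ)
    (s : Set α) :
    ∫⁻ a in s, ENNReal.ofReal (f a ^ r) ∂μ ≤
      (∫⁻ a in {a | l < f a}, ENNReal.ofReal (f a ^ r) ∂μ) + ENNReal.ofReal (l ^ r) * μ s := by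
  have hs : s ⊆ {a | l < f a} ∪ s ∩ {a | f a ≤ l} := fun a ha =>
    (lt_or_ge l (f a)).imp_right fun h_le => ⟨ha, h_le⟩
  refine (lintegral_mono_set hs).trans ((lintegral_union_le _ _ _).trans ?_)
  gcongr
  exact (setLIntegral_rpow_le_const_mul hr hf_nonneg (Eventually.of_forall fun a ha => ha.2)).trans
    (by gcongr; exact inter_subset_left)

theorem setLIntegral_rpow_le_sublevel_add (hr : 0 ≤ r) {f : α → ℝ} {c : ℝ} {s : Set α}
    (hf_nonneg : 0 ≤ f) (h : ∀ᵐ a ∂μ, a ∈ s → f a ≤ c) (l : ℝ) :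
    ∫⁻ a in s, ENNReal.ofReal (f a ^ r) ∂μ ≤
      (∫⁻ a in {a | f a ≤ l}, ENNReal.ofReal (f a ^ r) ∂μ) +
        ENNReal.ofReal (c ^ r) * μ {a | l < f a} := by
  have hs : s ⊆ {a | f a ≤ l} ∪ s ∩ {a | l < f a} := fun a ha =>
    (le_or_gt (f a) l).imp_right fun h_lt => ⟨ha, h_lt⟩
  refine (lintegral_mono_set hs).trans ((lintegral_union_le _ _ _).trans ?_)
  gcongr
  exact (setLIntegral_rpow_le_const_mul hr hf_nonneg (h.mono fun a h_le ha => h_le ha.1)).trans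
    (by gcongr; exact inter_subset_right)

end RpowIntegrals

section AprioriEstimate

variable {D X : Type*} [NormedAddCommGroup D] [NormedSpace ℂ D] [NormedAddCommGroup X]
  [NormedSpace ℂ X] {ι : D →L[ℂ] X} {T r : ℝ} {B : ℝ → D →L[ℂ] X}

/-- The estimate `‖u‖_{L^r(J; D)} + ‖u'‖_{L^r(J; X)} ≤ C ‖u' + B(·) u‖_{L^r(J; X)}` on
`MR_0^r(J; D, X)`, in terms of `r`-th powers. -/
def AprioriEstimate (ι : D →L[ℂ] X) (T r : ℝ) (A : ℝ≥0) (B : ℝ → D →L[ℂ] X) : Prop :=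
  ∀ (u : ℝ → D) (w : ℝ → X), MemLp u (ENNReal.ofReal r) (timeMeasure T) →
    MemLp w (ENNReal.ofReal r) (timeMeasure T) → IsPrimitivePair ι T u w →
    ∫⁻ t, ENNReal.ofReal ((‖u t‖ + ‖w t‖) ^ r) ∂(timeMeasure T) ≤
      A * ∫⁻ t, ENNReal.ofReal (‖w t + B t (u t)‖ ^ r) ∂(timeMeasure T)

theorem exists_aprioriEstimate_of_bijective [CompleteSpace D] [CompleteSpace X] (hr : 0 < r)
    [Fact (1 ≤ ENNReal.ofReal r)] (hB : IsAdmissible ι T B)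
    (h : Function.Bijective (parabolicOp (ENNReal.ofReal r) hB)) :
    ∃ A, AprioriEstimate ι T r A B := by
  obtain ⟨-, c, hc⟩ := (ContinuousLinearMap.bijective_iff_dense_range_and_antilipschitz _).1 h
  refine ⟨2 ^ r * (c ^ r + c ^ r), fun u w hu hw hpair => ?_⟩
  have component_le {N : ℝ} (hN : 0 ≤ N)
      (hN_le : N ≤ ‖(⟨_, toLp_mem_maxRegSpace hu hw hpair⟩ : maxRegSpace ι T _)‖) :
      ENNReal.ofReal (N ^ r) ≤
        c ^ r * ∫⁻ t, ENNReal.ofReal (‖w t + B t (u t)‖ ^ r) ∂(timeMeasure T) := by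
    rw [lintegral_ofReal_norm_rpow_of_ae_eq hr (parabolicOp_toLp_ae_eq hB hu hw hpair),
      ← ENNReal.ofReal_coe_nnreal, ENNReal.ofReal_rpow_of_nonneg c.coe_nonneg hr.le,
      ← ENNReal.ofReal_mul (by positivity), ← Real.mul_rpow c.coe_nonneg (norm_nonneg _)]
    gcongr
    exact hN_le.trans (ContinuousLinearMap.bound_of_antilipschitz _ hc _)
  calc ∫⁻ t, ENNReal.ofReal ((‖u t‖ + ‖w t‖) ^ r) ∂(timeMeasure T)
      ≤ 2 ^ r * ((∫⁻ t, ENNReal.ofReal (‖u t‖ ^ r) ∂(timeMeasure T)) +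
          ∫⁻ t, ENNReal.ofReal (‖w t‖ ^ r) ∂(timeMeasure T)) :=
        lintegral_add_rpow_le hr.le hu.1.norm.aemeasurable (fun _ => norm_nonneg _)
          fun _ => norm_nonneg _
    _ ≤ 2 ^ r * (c ^ r * (∫⁻ t, ENNReal.ofReal (‖w t + B t (u t)‖ ^ r) ∂(timeMeasure T)) +
          c ^ r * ∫⁻ t, ENNReal.ofReal (‖w t + B t (u t)‖ ^ r) ∂(timeMeasure T)) := by
        rw [lintegral_ofReal_norm_rpow_of_ae_eq hr hu.coeFn_toLp,
          lintegral_ofReal_norm_rpow_of_ae_eq hr hw.coeFn_toLp]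
        gcongr
        · exact component_le (norm_nonneg _) (norm_fst_le (hu.toLp u, hw.toLp w))
        · exact component_le (norm_nonneg _) (norm_snd_le (hu.toLp u, hw.toLp w))
    _ = ↑(2 ^ r * (c ^ r + c ^ r)) *
          ∫⁻ t, ENNReal.ofReal (‖w t + B t (u t)‖ ^ r) ∂(timeMeasure T) := by
        push_cast [ENNReal.coe_rpow_of_nonneg _ hr.le]
        ring

end AprioriEstimate

section LevelSetEstimates

variable {D X : Type*} [NormedAddCommGroup D] [NormedSpace ℂ D] [NormedAddCommGroup X]
  [NormedSpace ℂ X] {ι : D →L[ℂ] X} {T l r : ℝ} {B : ℝ → D →L[ℂ] X} {u v : ℝ → D} {w z : ℝ → X}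
  {O : Set ℝ}

theorem memLp_of_ae_eq_off_of_ae_le_on {α E : Type*} {mα : MeasurableSpace α}
    [NormedAddCommGroup E] {μ : Measure α} [IsFiniteMeasure μ] {p : ℝ≥0∞} {f g : α → E} {c : ℝ}
    {s : Set α} (hf : MemLp f p μ) (hg : AEStronglyMeasurable g μ) (hc : 0 ≤ c)
    (h_off : ∀ᵐ a ∂μ, a ∉ s → g a = f a) (h_on : ∀ᵐ a ∂μ, a ∈ s → ‖g a‖ ≤ c) : MemLp g p μ := by
  refine (hf.norm.add (memLp_const c)).mono hg ?_
  filter_upwards [h_off, h_on] with a ha_off ha_on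
  rw [Pi.add_apply, Real.norm_of_nonneg (by positivity)]
  by_cases ha : a ∈ s
  · linarith [ha_on ha, norm_nonneg (f a)]
  · linarith [congrArg norm (ha_off ha)]

theorem IsTruncation.memLp (h : IsTruncation ι T l u w O v z) (hl : 0 ≤ l) {p : ℝ≥0∞}
    (hu : MemLp u p (timeMeasure T)) (hw : MemLp w p (timeMeasure T)) :
    MemLp v p (timeMeasure T) ∧ MemLp z p (timeMeasure T) :=
  ⟨memLp_of_ae_eq_off_of_ae_le_on hu h.aestronglyMeasurable_fst (by positivity)
      (h.ae_eq_off.mono fun _ ht hO => (ht hO).1) (h.ae_le_on.mono fun _ ht hO => (ht hO).1),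
    memLp_of_ae_eq_off_of_ae_le_on hw h.aestronglyMeasurable_snd (by positivity)
      (h.ae_eq_off.mono fun _ ht hO => (ht hO).2.1) (h.ae_le_on.mono fun _ ht hO => (ht hO).2)⟩

theorem IsTruncation.ae_norm_le (h : IsTruncation ι T l u w O v z) (hl : 0 ≤ l) :
    ∀ᵐ t ∂(timeMeasure T), ‖v t‖ ≤ 12 * l ∧ ‖z t‖ ≤ 12 * l := by
  filter_upwards [h.ae_eq_off, h.ae_le_on] with t ht_off ht_on
  by_cases ht : t ∈ O
  · exact ⟨by linarith [(ht_on ht).1], (ht_on ht).2⟩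
  · obtain ⟨hv, hz, h_le⟩ := ht_off ht
    rw [hv, hz]
    constructor <;> linarith [norm_nonneg (u t), norm_nonneg (w t)]

theorem IsTruncation.isPrimitivePair_sub (h : IsTruncation ι T l u w O v z)
    (hpair : IsPrimitivePair ι T u w) (hw : Integrable w (timeMeasure T))
    (hz : Integrable z (timeMeasure T)) : IsPrimitivePair ι T (u - v) (w - z) := by
  have := hpair.add (h.isPrimitivePair.const_smul (-1)) hw (hz.smul (-1 : ℂ))
  simpa only [neg_one_smul, ← sub_eq_add_neg] using this

theorem IsTruncation.rpow_mul_measure_le (h : IsTruncation ι T l u w O v z) (hl : 0 < l) (r : ℝ) :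
    ENNReal.ofReal (l ^ r) * timeMeasure T O ≤ 10 * (ENNReal.ofReal (l ^ (r - 1)) *
      ∫⁻ t in {t | l / 2 < ‖u t‖ + ‖w t‖}, ENNReal.ofReal (‖u t‖ + ‖w t‖) ∂(timeMeasure T)) := by
  have rpow_mul_div : l ^ r * (10 / l) = 10 * l ^ (r - 1) := by
    rw [Real.rpow_sub_one hl.ne']
    ring
  calc _ ≤ ENNReal.ofReal (l ^ r) * (ENNReal.ofReal (10 / l) * _) := by gcongr; exact h.measure_le
    _ = _ := by
      rw [← mul_assoc, ← ENNReal.ofReal_mul (by positivity), rpow_mul_div,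
        ENNReal.ofReal_mul (by positivity), ENNReal.ofReal_ofNat, mul_assoc]

theorem ofReal_mul_rpow_mul {c : ℝ} (hc : 0 ≤ c) (hl : 0 ≤ l) (a : ℝ≥0∞) :
    ENNReal.ofReal ((c * l) ^ r) * a =
      ENNReal.ofReal (c ^ r) * (ENNReal.ofReal (l ^ r) * a) := by
  rw [Real.mul_rpow hc hl, ENNReal.ofReal_mul (by positivity), mul_assoc]

theorem IsTruncation.lintegral_residual_sub_le (h : IsTruncation ι T l u w O v z) (hl : 0 < l)
    (hr : 0 < r) {b : ℝ} (hb : 1 ≤ b) (hBv : ∀ᵐ t ∂(timeMeasure T), ‖B t (v t)‖ ≤ b * ‖v t‖)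
    (hm : AEMeasurable (fun t => ‖w t + B t (u t)‖) (timeMeasure T)) :
    ∫⁻ t, ENNReal.ofReal (‖(w - z) t + B t ((u - v) t)‖ ^ r) ∂(timeMeasure T) ≤ 2 ^ r *
      ((∫⁻ t in {t | l < ‖w t + B t (u t)‖}, ENNReal.ofReal (‖w t + B t (u t)‖ ^ r)
        ∂(timeMeasure T)) + (1 + ENNReal.ofReal ((20 * b) ^ r)) *
          (ENNReal.ofReal (l ^ r) * timeMeasure T O)) := by
  have eq_zero_off : ∫⁻ t in Oᶜ, ENNReal.ofReal (‖(w - z) t + B t ((u - v) t)‖ ^ r)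
      ∂(timeMeasure T) = 0 := by
    rw [setLIntegral_congr_fun_ae (g := fun _ => 0) h.measurableSet.compl, lintegral_zero]
    filter_upwards [h.ae_eq_off] with t ht_off ht
    simp [(ht_off ht).1, (ht_off ht).2.1, Real.zero_rpow hr.ne']
  have residual_le_on : ∀ᵐ t ∂(timeMeasure T), t ∈ O →
      ‖(w - z) t + B t ((u - v) t)‖ ≤ ‖w t + B t (u t)‖ + 20 * b * l := by
    filter_upwards [h.ae_le_on, hBv] with t ht_on hBvt ht
    obtain ⟨hv_le, hz_le⟩ := ht_on ht
    calc ‖(w - z) t + B t ((u - v) t)‖ = ‖(w t + B t (u t)) - (z t + B t (v t))‖ := by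
          rw [Pi.sub_apply, Pi.sub_apply, map_sub, sub_add_sub_comm]
      _ ≤ ‖w t + B t (u t)‖ + (‖z t‖ + ‖B t (v t)‖) :=
          (norm_sub_le _ _).trans (by gcongr; exact norm_add_le _ _)
      _ ≤ ‖w t + B t (u t)‖ + 20 * b * l := by nlinarith
  rw [← lintegral_add_compl _ h.measurableSet, eq_zero_off, add_zero]
  refine (setLIntegral_rpow_le_of_le_add hr.le hm (fun _ => norm_nonneg _)
    (fun _ => norm_nonneg _) (by positivity) h.measurableSet residual_le_on).trans ?_
  rw [ofReal_mul_rpow_mul (by positivity) hl.le, add_mul, one_mul, ← add_assoc]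
  gcongr
  exact setLIntegral_rpow_le_superlevel_add hr.le (fun _ => norm_nonneg _) l O

theorem IsTruncation.setLIntegral_superlevel_le (h : IsTruncation ι T l u w O v z) (hl : 0 < l)
    (hr : 0 ≤ r) (hu : AEStronglyMeasurable u (timeMeasure T))
    (hw : AEStronglyMeasurable w (timeMeasure T)) :
    ∫⁻ t in {t | l < ‖u t‖ + ‖w t‖}, ENNReal.ofReal ((‖u t‖ + ‖w t‖) ^ r) ∂(timeMeasure T) ≤
      2 ^ r * ((∫⁻ t, ENNReal.ofReal ((‖(u - v) t‖ + ‖(w - z) t‖) ^ r) ∂(timeMeasure T)) +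
        ENNReal.ofReal (20 ^ r) * (ENNReal.ofReal (l ^ r) * timeMeasure T O)) := by
  have superlevel_subset : {t | l < ‖u t‖ + ‖w t‖} ≤ᵐ[timeMeasure T] O := by
    filter_upwards [h.ae_eq_off] with t ht_off ht
    by_contra htO
    exact absurd (ht_off htO).2.2 (not_le.2 ht)
  have le_on : ∀ᵐ t ∂(timeMeasure T), t ∈ O →
      ‖u t‖ + ‖w t‖ ≤ (‖(u - v) t‖ + ‖(w - z) t‖) + 20 * l := by
    filter_upwards [h.ae_le_on] with t ht_on ht
    obtain ⟨hv_le, hz_le⟩ := ht_on ht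
    simp only [Pi.sub_apply]
    linarith [norm_sub_norm_le (u t) (v t), norm_sub_norm_le (w t) (z t)]
  have aemeasurable_sub :
      AEMeasurable (fun t => ‖(u - v) t‖ + ‖(w - z) t‖) (timeMeasure T) :=
    (hu.sub h.aestronglyMeasurable_fst).norm.aemeasurable.add
      (hw.sub h.aestronglyMeasurable_snd).norm.aemeasurable
  refine (lintegral_mono_set' superlevel_subset).trans ?_
  refine (setLIntegral_rpow_le_of_le_add hr aemeasurable_sub (fun _ => by positivity)
    (fun _ => by positivity) (by positivity) h.measurableSet le_on).trans ?_
  rw [ofReal_mul_rpow_mul (by positivity) hl.le]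
  gcongr
  exact Measure.restrict_le_self

theorem AprioriEstimate.exists_superlevelInequality [CompleteSpace D] [CompleteSpace X] {A : ℝ≥0}
    (hap : AprioriEstimate ι T r A B) (hr : 1 < r) (hB : IsAdmissible ι T B) :
    ∃ C : ℝ≥0, ∀ (u : ℝ → D) (w : ℝ → X), MemLp u (ENNReal.ofReal r) (timeMeasure T) →
      MemLp w (ENNReal.ofReal r) (timeMeasure T) → IsPrimitivePair ι T u w →
      SuperlevelInequality (timeMeasure T) r C (fun t => ‖u t‖ + ‖w t‖)
        fun t => ‖w t + B t (u t)‖ := by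
  have hr_pos : 0 < r := by linarith
  have one_le_exponent : 1 ≤ ENNReal.ofReal r := by simpa using ENNReal.ofReal_le_ofReal hr.le
  obtain ⟨b, hb, hBb⟩ := hB.exists_bound
  refine ⟨2 ^ r * (A * (2 ^ r * (1 + (1 + ((20 * b) ^ r).toNNReal) * 10)) +
    (20 ^ r : ℝ).toNNReal * 10), fun u w hu hw hpair l hl => ?_⟩
  obtain ⟨O, v, z, h⟩ :=
    exists_isTruncation hpair (hu.integrable one_le_exponent) (hw.integrable one_le_exponent) hl
  obtain ⟨hv, hz⟩ := h.memLp hl.le hu hw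
  have estimate_sub := hap (u - v) (w - z) (hu.sub hv) (hw.sub hz) <|
    h.isPrimitivePair_sub hpair (hw.integrable one_le_exponent) (hz.integrable one_le_exponent)
  have residual_sub_le := h.lintegral_residual_sub_le hl hr_pos hb (hBb v)
    (hw.1.add (aestronglyMeasurable_clm_apply hB.measurable hu.1)).norm.aemeasurable
  have superlevel_le := h.setLIntegral_superlevel_le hl hr_pos.le hu.1 hw.1
  have measure_le := h.rpow_mul_measure_le hl r
  push_cast [ENNReal.coe_rpow_of_nonneg _ hr_pos.le, ENNReal.ofNNReal_toNNReal]
  set S := ∫⁻ t in {t | l < ‖w t + B t (u t)‖}, ENNReal.ofReal (‖w t + B t (u t)‖ ^ r)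
    ∂(timeMeasure T)
  set M := ENNReal.ofReal (l ^ r) * timeMeasure T O
  set J := ENNReal.ofReal (l ^ (r - 1)) *
    ∫⁻ t in {t | l / 2 < ‖u t‖ + ‖w t‖}, ENNReal.ofReal (‖u t‖ + ‖w t‖) ∂(timeMeasure T)
  have hM : M ≤ 10 * (S + J) := measure_le.trans (by gcongr; exact le_add_self)
  calc _ ≤ 2 ^ r * (A * (2 ^ r * (S + (1 + ENNReal.ofReal ((20 * b) ^ r)) * M)) +
        ENNReal.ofReal (20 ^ r) * M) :=
        superlevel_le.trans (by gcongr; exact estimate_sub.trans (by gcongr))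
    _ ≤ 2 ^ r * (A * (2 ^ r * ((S + J) + (1 + ENNReal.ofReal ((20 * b) ^ r)) * (10 * (S + J)))) +
        ENNReal.ofReal (20 ^ r) * (10 * (S + J))) := by
        gcongr
        exact le_self_add
    _ = _ := by ring

theorem IsTruncation.lintegral_residual_le (h : IsTruncation ι T l u w O v z) (hl : 0 < l)
    (hr : 0 ≤ r) {b : ℝ} (hb : 1 ≤ b) (hBv : ∀ᵐ t ∂(timeMeasure T), ‖B t (v t)‖ ≤ b * ‖v t‖) :
    ∫⁻ t, ENNReal.ofReal (‖z t + B t (v t)‖ ^ r) ∂(timeMeasure T) ≤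
      (∫⁻ t in {t | ‖w t + B t (u t)‖ ≤ l}, ENNReal.ofReal (‖w t + B t (u t)‖ ^ r)
        ∂(timeMeasure T)) +
      ENNReal.ofReal (b ^ r) *
        (ENNReal.ofReal (l ^ r) * timeMeasure T {t | l < ‖w t + B t (u t)‖}) +
      ENNReal.ofReal ((20 * b) ^ r) * (ENNReal.ofReal (l ^ r) * timeMeasure T O) := by
  have residual_le_on : ∀ᵐ t ∂(timeMeasure T), t ∈ O → ‖z t + B t (v t)‖ ≤ 20 * b * l := by
    filter_upwards [h.ae_le_on, hBv] with t ht_on hBvt ht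
    obtain ⟨hv_le, hz_le⟩ := ht_on ht
    exact (norm_add_le _ _).trans (by nlinarith)
  have residual_le_off : ∀ᵐ t ∂(timeMeasure T), t ∈ Oᶜ → ‖w t + B t (u t)‖ ≤ b * l := by
    filter_upwards [h.ae_eq_off, hBv] with t ht_off hBvt ht
    obtain ⟨hv_eq, -, h_le⟩ := ht_off ht
    rw [hv_eq] at hBvt
    calc ‖w t + B t (u t)‖ ≤ b * ‖w t‖ + b * ‖u t‖ :=
          norm_add_le_of_le (le_mul_of_one_le_left (norm_nonneg _) hb) hBvt
      _ ≤ b * l := by nlinarith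
  have residual_eq_off : ∫⁻ t in Oᶜ, ENNReal.ofReal (‖z t + B t (v t)‖ ^ r) ∂(timeMeasure T) =
      ∫⁻ t in Oᶜ, ENNReal.ofReal (‖w t + B t (u t)‖ ^ r) ∂(timeMeasure T) := by
    refine setLIntegral_congr_fun_ae h.measurableSet.compl ?_
    filter_upwards [h.ae_eq_off] with t ht_off ht
    rw [(ht_off ht).1, (ht_off ht).2.1]
  rw [← lintegral_add_compl _ h.measurableSet, add_comm, residual_eq_off,
    ← ofReal_mul_rpow_mul (by positivity) hl.le, ← ofReal_mul_rpow_mul (by positivity) hl.le]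
  exact add_le_add
    (setLIntegral_rpow_le_sublevel_add hr (fun _ => norm_nonneg _) residual_le_off l)
    (setLIntegral_rpow_le_const_mul hr (fun _ => norm_nonneg _) residual_le_on)

theorem IsTruncation.setLIntegral_sublevel_le (h : IsTruncation ι T l u w O v z) (hr : 0 ≤ r) :
    ∫⁻ t in {t | ‖u t‖ + ‖w t‖ ≤ l}, ENNReal.ofReal ((‖u t‖ + ‖w t‖) ^ r) ∂(timeMeasure T) ≤
      (∫⁻ t, ENNReal.ofReal ((‖v t‖ + ‖z t‖) ^ r) ∂(timeMeasure T)) +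
        ENNReal.ofReal (l ^ r) * timeMeasure T O := by
  set sublevel := {t | ‖u t‖ + ‖w t‖ ≤ l}
  have eq_off : ∫⁻ t in Oᶜ, ENNReal.ofReal ((‖u t‖ + ‖w t‖) ^ r) ∂(timeMeasure T) =
      ∫⁻ t in Oᶜ, ENNReal.ofReal ((‖v t‖ + ‖z t‖) ^ r) ∂(timeMeasure T) := by
    refine setLIntegral_congr_fun_ae h.measurableSet.compl ?_
    filter_upwards [h.ae_eq_off] with t ht_off ht
    rw [(ht_off ht).1, (ht_off ht).2.1]
  have sublevel_subset : sublevel ⊆ Oᶜ ∪ O ∩ sublevel := fun t ht =>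
    (em (t ∈ O)).symm.imp_right fun htO => ⟨htO, ht⟩
  refine (lintegral_mono_set sublevel_subset).trans ((lintegral_union_le _ _ _).trans ?_)
  refine add_le_add (eq_off.le.trans (setLIntegral_le_lintegral _ _)) ?_
  exact (setLIntegral_rpow_le_const_mul hr (fun _ => by positivity)
    (Eventually.of_forall fun t ht => ht.2)).trans (by gcongr; exact inter_subset_left)

theorem AprioriEstimate.exists_sublevelInequality [CompleteSpace D] [CompleteSpace X] {A : ℝ≥0}
    (hap : AprioriEstimate ι T r A B) (hr : 0 ≤ r) (hB : IsAdmissible ι T B) :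
    ∃ C : ℝ≥0, ∀ (u : ℝ → D) (w : ℝ → X), Integrable u (timeMeasure T) →
      Integrable w (timeMeasure T) → IsPrimitivePair ι T u w →
      SublevelInequality (timeMeasure T) r C (fun t => ‖u t‖ + ‖w t‖)
        fun t => ‖w t + B t (u t)‖ := by
  obtain ⟨b, hb, hBb⟩ := hB.exists_bound
  refine ⟨A * (1 + (b ^ r).toNNReal + ((20 * b) ^ r).toNNReal * 10) + 10,
    fun u w hu hw hpair l hl => ?_⟩
  obtain ⟨O, v, z, h⟩ := exists_isTruncation hpair hu hw hl
  have estimate := hap v z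
    (MemLp.of_bound h.aestronglyMeasurable_fst _ ((h.ae_norm_le hl.le).mono fun t ht => ht.1))
    (MemLp.of_bound h.aestronglyMeasurable_snd _ ((h.ae_norm_le hl.le).mono fun t ht => ht.2))
    h.isPrimitivePair
  have residual_le := h.lintegral_residual_le hl hr hb (hBb v)
  have sublevel_le := h.setLIntegral_sublevel_le hr
  have measure_le := h.rpow_mul_measure_le hl r
  push_cast [ENNReal.ofNNReal_toNNReal]
  set S := ∫⁻ t in {t | ‖w t + B t (u t)‖ ≤ l}, ENNReal.ofReal (‖w t + B t (u t)‖ ^ r)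
    ∂(timeMeasure T)
  set N := ENNReal.ofReal (l ^ r) * timeMeasure T {t | l < ‖w t + B t (u t)‖}
  set M := ENNReal.ofReal (l ^ r) * timeMeasure T O
  set J := ENNReal.ofReal (l ^ (r - 1)) *
    ∫⁻ t in {t | l / 2 < ‖u t‖ + ‖w t‖}, ENNReal.ofReal (‖u t‖ + ‖w t‖) ∂(timeMeasure T)
  have hS : S ≤ S + N + J := le_self_add.trans le_self_add
  have hN : N ≤ S + N + J := le_add_self.trans le_self_add
  have hM : M ≤ 10 * (S + N + J) := measure_le.trans (by gcongr; exact le_add_self)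
  calc _ ≤ A * (S + ENNReal.ofReal (b ^ r) * N + ENNReal.ofReal ((20 * b) ^ r) * M) + M :=
        sublevel_le.trans (by gcongr; exact estimate.trans (by gcongr))
    _ ≤ A * ((S + N + J) + ENNReal.ofReal (b ^ r) * (S + N + J) +
          ENNReal.ofReal ((20 * b) ^ r) * (10 * (S + N + J))) + 10 * (S + N + J) := by gcongr
    _ = _ := by ring

end LevelSetEstimates

section Extrapolation

variable {D X : Type*} [NormedAddCommGroup D] [NormedSpace ℂ D] [NormedAddCommGroup X]
  [NormedSpace ℂ X] {ι : D →L[ℂ] X} {T r s : ℝ} {A C : ℝ≥0} {B : ℝ → D →L[ℂ] X}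

theorem AprioriEstimate.exists_antilipschitzWith [Fact (1 ≤ ENNReal.ofReal s)] (hs : 0 < s)
    (hap : AprioriEstimate ι T s A B) (hB : IsAdmissible ι T B) :
    ∃ c, AntilipschitzWith c (parabolicOp (ENNReal.ofReal s) hB) := by
  refine ⟨A ^ (1 / s), ContinuousLinearMap.antilipschitz_of_bound _ fun x => ?_⟩
  have estimate := hap x.1.1 x.1.2 (Lp.memLp _) (Lp.memLp _) x.2
  rw [lintegral_ofReal_norm_rpow_of_ae_eq hs (coeFn_parabolicOp hB x),
    ← ENNReal.ofReal_coe_nnreal, ← ENNReal.ofReal_mul A.coe_nonneg] at estimate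
  have le_of_rpow_le {N : ℝ} (hN : 0 ≤ N) (hN_le : ENNReal.ofReal (N ^ s) ≤
      ∫⁻ t, ENNReal.ofReal ((‖x.1.1 t‖ + ‖x.1.2 t‖) ^ s) ∂(timeMeasure T)) :
      N ≤ (A : ℝ) ^ (1 / s) * ‖parabolicOp _ hB x‖ := by
    rw [← Real.rpow_le_rpow_iff hN (by positivity) hs,
      Real.mul_rpow (by positivity) (norm_nonneg _), ← Real.rpow_mul A.coe_nonneg,
      one_div_mul_cancel hs.ne', Real.rpow_one]
    exact (ENNReal.ofReal_le_ofReal_iff (by positivity)).1 (hN_le.trans estimate)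
  rw [NNReal.coe_rpow]
  refine max_le (le_of_rpow_le (norm_nonneg x.1.1) ?_) (le_of_rpow_le (norm_nonneg x.1.2) ?_)
  · rw [← lintegral_ofReal_norm_rpow_of_ae_eq hs EventuallyEq.rfl]
    gcongr
    exact le_add_of_nonneg_right (norm_nonneg _)
  · rw [← lintegral_ofReal_norm_rpow_of_ae_eq hs EventuallyEq.rfl]
    gcongr
    exact le_add_of_nonneg_left (norm_nonneg _)

theorem SuperlevelInequality.memLp {u : ℝ → D} {w : ℝ → X} {μ : Measure ℝ}
    (H : SuperlevelInequality μ r C (fun t => ‖u t‖ + ‖w t‖) fun t => ‖w t + B t (u t)‖)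
    (hr : 1 < r) (hrs : r < s) (hsmall : C * (s - r) * (2 ^ (s - 1) / (s - 1)) ≤ 1 / 2)
    (hu : MemLp u (ENNReal.ofReal r) μ) (hw : MemLp w (ENNReal.ofReal r) μ)
    (hf : MemLp (fun t => w t + B t (u t)) (ENNReal.ofReal s) μ) :
    MemLp u (ENNReal.ofReal s) μ ∧ MemLp w (ENNReal.ofReal s) μ := by
  have hs : 0 < s := by linarith
  have lintegral_ne_top : ∫⁻ t, ENNReal.ofReal ((‖u t‖ + ‖w t‖) ^ s) ∂μ ≠ ⊤ :=
    ne_top_of_le_ne_top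
      (ENNReal.mul_ne_top (by simp) (ENNReal.mul_ne_top ENNReal.coe_ne_top
        (lintegral_ofReal_norm_rpow_ne_top hs hf)))
      (H.lintegral_rpow_le (hu.1.norm.aemeasurable.add hw.1.norm.aemeasurable)
        hf.1.norm.aemeasurable (fun _ => by positivity) (fun _ => norm_nonneg _) hr hrs
        (lintegral_norm_add_norm_rpow_ne_top (by linarith) hu hw) hsmall)
  exact ⟨memLp_of_lintegral_rpow_ne_top hs hu.1
      (fun _ => le_add_of_nonneg_right (norm_nonneg _)) lintegral_ne_top,
    memLp_of_lintegral_rpow_ne_top hs hw.1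
      (fun _ => le_add_of_nonneg_left (norm_nonneg _)) lintegral_ne_top⟩

theorem aprioriEstimate_of_sublevelInequality (hB : IsAdmissible ι T B)
    (H : ∀ (u : ℝ → D) (w : ℝ → X), Integrable u (timeMeasure T) →
      Integrable w (timeMeasure T) → IsPrimitivePair ι T u w →
      SublevelInequality (timeMeasure T) r C (fun t => ‖u t‖ + ‖w t‖)
        fun t => ‖w t + B t (u t)‖)
    (hs : 1 < s) (hsr : s < r) (hsmall : C * (r - s) * (2 ^ (s - 1) / (s - 1)) ≤ 1 / 2) :
    AprioriEstimate ι T s (2 * (C * r.toNNReal)) B := by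
  intro u w hu hw hpair
  have one_le_exponent : 1 ≤ ENNReal.ofReal s := by simpa using ENNReal.ofReal_le_ofReal hs.le
  have estimate := (H u w (hu.integrable one_le_exponent) (hw.integrable one_le_exponent)
      hpair).lintegral_rpow_le (hu.1.norm.aemeasurable.add hw.1.norm.aemeasurable)
    (hw.1.add (aestronglyMeasurable_clm_apply hB.measurable hu.1)).norm.aemeasurable
    (fun _ => by positivity) (fun _ => norm_nonneg _) hs hsr
    (lintegral_norm_add_norm_rpow_ne_top (by linarith) hu hw) hsmall
  push_cast [ENNReal.ofNNReal_toNNReal]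
  rwa [mul_assoc]

variable [CompleteSpace X]

theorem HasMaxReg.of_gt (h : HasMaxReg ι T r B) (hT : 0 < T) (hr : 1 ≤ r) (hrs : r < s)
    (memLp_of_residual : ∀ (u : ℝ → D) (w : ℝ → X), MemLp u (ENNReal.ofReal r) (timeMeasure T) →
      MemLp w (ENNReal.ofReal r) (timeMeasure T) → IsPrimitivePair ι T u w →
      MemLp (fun t => w t + B t (u t)) (ENNReal.ofReal s) (timeMeasure T) →
      MemLp u (ENNReal.ofReal s) (timeMeasure T) ∧ MemLp w (ENNReal.ofReal s) (timeMeasure T)) :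
    HasMaxReg ι T s B := by
  have exponent_le := ENNReal.ofReal_le_ofReal hrs.le
  refine ⟨h.admissible, fun f hf => ?_⟩
  obtain ⟨u, hu, unique⟩ := h.exists_unique f (MemLp.mono_exponent hf exponent_le)
  refine ⟨u, ?_, fun v hv => unique v ?_⟩
  · obtain ⟨hur, w, hwr, hpair, h_eq⟩ := (memMR_and_solvesAE_iff hT hr).1 hu
    obtain ⟨hus, hws⟩ := memLp_of_residual u w hur hwr hpair ((memLp_congr_ae h_eq).2 hf)
    exact (memMR_and_solvesAE_iff hT (by linarith)).2 ⟨hus, w, hws, hpair, h_eq⟩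
  · obtain ⟨hvs, w, hws, hpair, h_eq⟩ := (memMR_and_solvesAE_iff hT (by linarith)).1 hv
    exact (memMR_and_solvesAE_iff hT hr).2
      ⟨MemLp.mono_exponent hvs exponent_le, w, MemLp.mono_exponent hws exponent_le, hpair, h_eq⟩

theorem HasMaxReg.denseRange_parabolicOp [Fact (1 ≤ ENNReal.ofReal s)] (h : HasMaxReg ι T r B)
    (hT : 0 < T) (hr : 1 ≤ r) (hsr : s ≤ r) :
    DenseRange (parabolicOp (ENNReal.ofReal s) h.admissible) := by
  -- Simple functions lie in `L^r(J; X)`, so they are in the range of the parabolic operator.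
  have exponent_le := ENNReal.ofReal_le_ofReal hsr
  refine Dense.mono ?_ (Lp.simpleFunc.denseRange (E := X) (μ := timeMeasure T)
    (p := ENNReal.ofReal s) ENNReal.ofReal_ne_top)
  rintro _ ⟨f, rfl⟩
  obtain ⟨u, hu, -⟩ := h.exists_unique (Lp.simpleFunc.toSimpleFunc f)
    (SimpleFunc.memLp_of_isFiniteMeasure _ _ _)
  obtain ⟨hur, w, hwr, hpair, h_eq⟩ := (memMR_and_solvesAE_iff hT hr).1 hu
  have hus : MemLp u (ENNReal.ofReal s) (timeMeasure T) := MemLp.mono_exponent hur exponent_le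
  have hws : MemLp w (ENNReal.ofReal s) (timeMeasure T) := MemLp.mono_exponent hwr exponent_le
  exact ⟨⟨_, toLp_mem_maxRegSpace hus hws hpair⟩,
    Lp.ext (((parabolicOp_toLp_ae_eq h.admissible hus hws hpair).trans h_eq).trans
      (Lp.simpleFunc.toSimpleFunc_eq_toFun f))⟩

variable [CompleteSpace D]

theorem HasMaxReg.of_lt (h : HasMaxReg ι T r B) (hT : 0 < T) (hs : 1 ≤ s) (hsr : s ≤ r)
    (hap : AprioriEstimate ι T s A B) : HasMaxReg ι T s B := by
  have : Fact (1 ≤ ENNReal.ofReal s) := ⟨by simpa using ENNReal.ofReal_le_ofReal hs⟩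
  refine hasMaxReg_of_bijective_parabolicOp hT hs h.admissible
    ((ContinuousLinearMap.bijective_iff_dense_range_and_antilipschitz _).2
      ⟨?_, hap.exists_antilipschitzWith (by linarith) h.admissible⟩)
  exact Submodule.dense_iff_topologicalClosure_eq_top.1
    (h.denseRange_parabolicOp hT (hs.trans hsr) hsr)

theorem HasMaxReg.exists_aprioriEstimate (h : HasMaxReg ι T r B) (hT : 0 < T) (hr : 1 ≤ r) :
    ∃ A, AprioriEstimate ι T r A B := by
  have : Fact (1 ≤ ENNReal.ofReal r) := ⟨by simpa using ENNReal.ofReal_le_ofReal hr⟩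
  exact exists_aprioriEstimate_of_bijective (by linarith) h.admissible
    (h.bijective_parabolicOp hT hr)

theorem eventually_mul_abs_sub_mul_le (C : ℝ) (hr : 1 < r) :
    ∀ᶠ s in 𝓝 r, C * |s - r| * (2 ^ (s - 1) / (s - 1)) ≤ 1 / 2 := by
  have continuousAt : ContinuousAt (fun s : ℝ => C * |s - r| * (2 ^ (s - 1) / (s - 1))) r := by
    have : r - 1 ≠ 0 := by linarith
    fun_prop (disch := simp [*])
  refine continuousAt.eventually_le_const ?_
  simp

theorem HasMaxReg.eventually_nhds (h : HasMaxReg ι T r B) (hT : 0 < T) (hr : 1 < r) :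
    ∀ᶠ s in 𝓝 r, HasMaxReg ι T s B := by
  obtain ⟨A, hap⟩ := h.exists_aprioriEstimate hT hr.le
  obtain ⟨C₁, superlevel⟩ := hap.exists_superlevelInequality hr h.admissible
  obtain ⟨C₂, sublevel⟩ := hap.exists_sublevelInequality (by linarith) h.admissible
  filter_upwards [eventually_mul_abs_sub_mul_le C₁ hr, eventually_mul_abs_sub_mul_le C₂ hr,
    lt_mem_nhds hr] with s small₁ small₂ hs
  rcases lt_trichotomy s r with hsr | rfl | hrs
  · rw [abs_sub_comm, abs_of_pos (sub_pos.2 hsr)] at small₂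
    exact h.of_lt hT hs.le hsr.le
      (aprioriEstimate_of_sublevelInequality h.admissible sublevel hs hsr small₂)
  · exact h
  · rw [abs_of_pos (sub_pos.2 hrs)] at small₁
    exact h.of_gt hT hr.le hrs fun u w hu hw hpair =>
      (superlevel u w hu hw hpair).memLp hr hrs small₁ hu hw

end Extrapolation

end ParabolicReg

theorem corollary3p5_general
    {D : Type*} [NormedAddCommGroup D] [NormedSpace ℂ D] [CompleteSpace D]
    {X : Type*} [NormedAddCommGroup X] [NormedSpace ℂ X] [CompleteSpace X]
    (ι : D →L[ℂ] X) (T : ℝ) (hT : 0 < T) (B : ℝ → D →L[ℂ] X)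
    (r : ℝ) (hr : 1 < r) (hBr : ParabolicReg.HasMaxReg ι T r B) :
    ∃ a b : ℝ, Ioo a b ⊆ Ioi 1 ∧ r ∈ Ioo a b ∧
      ∀ s ∈ Ioo a b, ParabolicReg.HasMaxReg ι T s B := by
  obtain ⟨a, b, hab, h⟩ := mem_nhds_iff_exists_Ioo_subset.1
    ((lt_mem_nhds hr).and (hBr.eventually_nhds hT hr))
  exact ⟨a, b, fun s hs => (h hs).1, hab, fun s hs => (h hs).2⟩

theorem corollary3p5
    {D : Type*} [NormedAddCommGroup D] [NormedSpace ℂ D] [CompleteSpace D]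
    {X : Type*} [NormedAddCommGroup X] [NormedSpace ℂ X] [CompleteSpace X]
    (ι : D →L[ℂ] X) (hι_inj : Function.Injective ι) (hι_dense : DenseRange ι)
    (T : ℝ) (hT : 0 < T)
    (B : ℝ → D →L[ℂ] X) (hB : ParabolicReg.IsAdmissible ι T B)
    (K : D →L[ℂ] X) (hK : ParabolicReg.HasAutonomousMaxReg ι T K)
    (r : ℝ) (hr : 1 < r) (hBr : ParabolicReg.HasMaxReg ι T r B) :
    ∃ a b : ℝ, Ioo a b ⊆ Ioi 1 ∧ r ∈ Ioo a b ∧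
      ∀ s ∈ Ioo a b, ParabolicReg.HasMaxReg ι T s B :=
  corollary3p5_general ι T hT B r hr hBr
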